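/- Let $n\ge 1$ be an integer. For $a<b$, consider on the cylinder $\Sigma=[a,b]\times\mathbb S^1$ (with $\mathbb S^1=\mathbb R/2\pi\mathbb Z$) the rotationally symmetric metrics $g=f(t)^2(dt^2+d\theta^2)$ with $f$ smooth and positive on $[a,b]$. Let $0=\sigma_0(g)<\sigma_1(g)\le\sigma_2(g)\le\cdots$ be the Steklov eigenvalues of $(\Sigma,g)$, that is, the eigenvalues, repeated according to multiplicity, of the Dirichlet-to-Neumann map, which sends a smooth function on $\partial\Sigma$ to the outward unit normal derivative of its harmonic extension to $\Sigma$. Let $\tilde\sigma_k(g)=\sigma_k(g)\,L_g(\partial\Sigma)$ be the normalized eigenvalues, where $L_g(\partial\Sigma)$ is the length of the boundary. For $m\ge1$ put $$\tilde\lambda_m(\beta,T)=\frac{4m\pi}{\beta}\Bigl(\coth(mT)-\sqrt{\coth^2(mT)-\beta}\Bigr),\qquad \tilde\mu_m(\beta,T)=\frac{4m\pi}{\beta}\Bigl(\coth(mT)+\sqrt{\coth^2(mT)-\beta}\Bigr).$$ **Theorem.** There is a unique $T>0$ with $\tilde\lambda_{2n}(1,T)=\tilde\mu_1(1,T)$;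 denote it by $T_{2n,1}(1)$. Let $$X(t,\theta)=(2n\sinh t\cos\theta,\;2n\sinh t\sin\theta,\;\cosh(2nt)\cos(2n\theta),\;\cosh(2nt)\sin(2n\theta)),\qquad t\in[-T_{2n,1}(1)/2,\,T_{2n,1}(1)/2].$$ Then: 1. $X$ is a smooth immersion of the cylinder $[-T_{2n,1}(1)/2,T_{2n,1}(1)/2]\times\mathbb S^1$ into $\mathbb R^4$; it is invariant under $(t,\theta)\mapsto(-t,\theta+\pi)$, so it descends to an immersed Möbius band (the critical $n$-Möbius band); and it is minimal. 2. For some $R>0$, $X$ maps the interior of the cylinder into the open ball of radius $R$ about the origin and the boundary into its boundary sphere, and the surface meets this sphere orthogonally along the boundary. 3. The metric induced by $X$ is of the form $g_0=f_0(t)^2(dt^2+d\theta^2)$, and it attains the maximum of the normalized $4n$-th Steklov eigenvalue: $\tilde\sigma_{4n}(g)\le\tilde\sigma_{4n}(g_0)$ for all $a<b$ and all rotationally symmetric metrics $g=f(t)^2(dt^2+d\theta^2)$ on $[a,b]\times\mathbb S^1$. -/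

import Mathlib

open scoped ContDiff RealInnerProductSpace
open Set

/-! Points of a cylinder `[a, b] × 𝕊¹` are written `(t, θ)`; functions and maps on it are given as
functions on `ℝ × ℝ`, of which only the values on `[a, b] × ℝ` matter, and which are
`2π`-periodic in `θ` there. -/

/-- A rotationally symmetric metric `g = f(t)² (dt² + dθ²)` on a cylinder `[a, b] × 𝕊¹`,
where `f` is smooth and positive on `[a, b]`. -/
structure RotMetric where
  a : ℝ
  b : ℝ
  a_lt_b : a < b
  f : ℝ → ℝ
  smooth : ContDiffOn ℝ ∞ f (Icc a b)
  pos : ∀ t ∈ Icc a b, 0 < f t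

namespace RotMetric

/-- The total length `L_g(∂Σ)` of the two boundary circles. -/
noncomputable def boundaryLength (g : RotMetric) : ℝ :=
  2 * Real.pi * g.f g.a + 2 * Real.pi * g.f g.b

/-- The Laplace-Beltrami operator of `g`: `Δ_g u = f⁻² (∂²u/∂t² + ∂²u/∂θ²)`. -/
noncomputable def laplacian (g : RotMetric) (u : ℝ × ℝ → ℝ) (p : ℝ × ℝ) : ℝ :=
  (g.f p.1 ^ 2)⁻¹ *
    (iteratedDeriv 2 (fun t => u (t, p.2)) p.1 + iteratedDeriv 2 (fun θ => u (p.1, θ)) p.2)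

/-- The derivative of `u` along the outward unit normal `-f(a)⁻¹ ∂/∂t` at `(a, θ)`. -/
noncomputable def normalDerivLeft (g : RotMetric) (u : ℝ × ℝ → ℝ) (θ : ℝ) : ℝ :=
  -((g.f g.a)⁻¹ * derivWithin (fun t => u (t, θ)) (Icc g.a g.b) g.a)

/-- The derivative of `u` along the outward unit normal `f(b)⁻¹ ∂/∂t` at `(b, θ)`. -/
noncomputable def normalDerivRight (g : RotMetric) (u : ℝ × ℝ → ℝ) (θ : ℝ) : ℝ :=
  (g.f g.b)⁻¹ * derivWithin (fun t => u (t, θ)) (Icc g.a g.b) g.b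

/-- `u` is a function on the cylinder, smooth up to the boundary, and harmonic for `g`. -/
structure IsHarmonic (g : RotMetric) (u : ℝ × ℝ → ℝ) : Prop where
  smooth : ContDiffOn ℝ ∞ u (Icc g.a g.b ×ˢ univ)
  periodic : ∀ t ∈ Icc g.a g.b, ∀ θ, u (t, θ + 2 * Real.pi) = u (t, θ)
  harmonic : ∀ t ∈ Ioo g.a g.b, ∀ θ, g.laplacian u (t, θ) = 0

/-- The function `φ = (φ.1, φ.2)` on the boundary (`φ.1` on `{a} × 𝕊¹`, `φ.2` on `{b} × 𝕊¹`)
satisfies `L_g φ = σ φ`, where `L_g` is the Dirichlet-to-Neumann map: `φ` has a harmonic extension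
`u`, and the outward normal derivative of `u` is `σ φ`. -/
def IsSteklovEigenfunction (g : RotMetric) (σ : ℝ) (φ : (ℝ → ℝ) × (ℝ → ℝ)) : Prop :=
  ∃ u : ℝ × ℝ → ℝ, g.IsHarmonic u ∧
    (∀ θ, u (g.a, θ) = φ.1 θ) ∧ (∀ θ, u (g.b, θ) = φ.2 θ) ∧
    (∀ θ, g.normalDerivLeft u θ = σ * φ.1 θ) ∧ (∀ θ, g.normalDerivRight u θ = σ * φ.2 θ)

theorem IsSteklovEigenfunction.add {g : RotMetric} {σ : ℝ} {φ ψ : (ℝ → ℝ) × (ℝ → ℝ)}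
    (hφ : g.IsSteklovEigenfunction σ φ) (hψ : g.IsSteklovEigenfunction σ ψ) :
    g.IsSteklovEigenfunction σ (φ + ψ) := by
  obtain ⟨u, hu, hu1, hu2, hu3, hu4⟩ := hφ
  obtain ⟨v, hv, hv1, hv2, hv3, hv4⟩ := hψ
  have ha : g.a ∈ Icc g.a g.b := left_mem_Icc.2 g.a_lt_b.le
  have hb : g.b ∈ Icc g.a g.b := right_mem_Icc.2 g.a_lt_b.le
  have slice : ∀ {w : ℝ × ℝ → ℝ}, g.IsHarmonic w → ∀ t ∈ Icc g.a g.b, ∀ θ,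
      DifferentiableWithinAt ℝ (fun s => w (s, θ)) (Icc g.a g.b) t := by
    intro w hw t ht θ
    have h1 := hw.smooth.differentiableOn (by simp) (t, θ) ⟨ht, mem_univ _⟩
    exact h1.comp (f := fun s : ℝ => (s, θ)) t (by fun_prop) (fun s hs => ⟨hs, mem_univ _⟩)
  have inner : ∀ {w : ℝ × ℝ → ℝ}, g.IsHarmonic w → ∀ t ∈ Ioo g.a g.b, ∀ θ,
      ContDiffAt ℝ 2 w (t, θ) := by
    intro w hw t ht θ
    exact (hw.smooth.contDiffAt (prod_mem_nhds (Icc_mem_nhds ht.1 ht.2) Filter.univ_mem)).of_le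
      (WithTop.coe_le_coe.2 le_top)
  refine ⟨u + v, ⟨hu.smooth.add hv.smooth, ?_, ?_⟩, ?_, ?_, ?_, ?_⟩
  · intro t ht θ
    simp [hu.periodic t ht θ, hv.periodic t ht θ]
  · intro t ht θ
    have e1 : iteratedDeriv 2 (fun s => (u + v) (s, θ)) t
        = iteratedDeriv 2 (fun s => u (s, θ)) t + iteratedDeriv 2 (fun s => v (s, θ)) t :=
      iteratedDeriv_fun_add
        ((inner hu t ht θ).comp (f := fun s : ℝ => (s, θ)) t (by fun_prop))
        ((inner hv t ht θ).comp (f := fun s : ℝ => (s, θ)) t (by fun_prop))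
    have e2 : iteratedDeriv 2 (fun s => (u + v) (t, s)) θ
        = iteratedDeriv 2 (fun s => u (t, s)) θ + iteratedDeriv 2 (fun s => v (t, s)) θ :=
      iteratedDeriv_fun_add
        ((inner hu t ht θ).comp (f := fun s : ℝ => (t, s)) θ (by fun_prop))
        ((inner hv t ht θ).comp (f := fun s : ℝ => (t, s)) θ (by fun_prop))
    have h1 := hu.harmonic t ht θ
    have h2 := hv.harmonic t ht θ
    simp only [laplacian] at h1 h2 ⊢
    rw [e1, e2]
    linear_combination h1 + h2
  · intro θ; simp [hu1, hv1]
  · intro θ; simp [hu2, hv2]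
  · intro θ
    have e : derivWithin (fun s => (u + v) (s, θ)) (Icc g.a g.b) g.a = _ :=
      derivWithin_fun_add (slice hu g.a ha θ) (slice hv g.a ha θ)
    have h1 := hu3 θ
    have h2 := hv3 θ
    simp only [normalDerivLeft, Prod.fst_add, Pi.add_apply] at h1 h2 e ⊢
    rw [e]
    linear_combination h1 + h2
  · intro θ
    have e : derivWithin (fun s => (u + v) (s, θ)) (Icc g.a g.b) g.b = _ :=
      derivWithin_fun_add (slice hu g.b hb θ) (slice hv g.b hb θ)
    have h1 := hu4 θ
    have h2 := hv4 θ
    simp only [normalDerivRight, Prod.snd_add, Pi.add_apply] at h1 h2 e ⊢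
    rw [e]
    linear_combination h1 + h2

theorem IsSteklovEigenfunction.smul {g : RotMetric} {σ : ℝ} {φ : (ℝ → ℝ) × (ℝ → ℝ)} (c : ℝ)
    (hφ : g.IsSteklovEigenfunction σ φ) : g.IsSteklovEigenfunction σ (c • φ) := by
  obtain ⟨u, hu, hu1, hu2, hu3, hu4⟩ := hφ
  refine ⟨fun p => c * u p, ⟨contDiffOn_const.mul hu.smooth, ?_, ?_⟩, ?_, ?_, ?_, ?_⟩
  · intro t ht θ
    simp [hu.periodic t ht θ]
  · intro t ht θ
    have h1 := hu.harmonic t ht θ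
    simp only [laplacian, iteratedDeriv_const_mul_field] at h1 ⊢
    linear_combination c * h1
  · intro θ; simp [hu1]
  · intro θ; simp [hu2]
  · intro θ
    have h1 := hu3 θ
    simp only [normalDerivLeft, derivWithin_const_mul_field, Prod.smul_fst, Pi.smul_apply,
      smul_eq_mul] at h1 ⊢
    linear_combination c * h1
  · intro θ
    have h1 := hu4 θ
    simp only [normalDerivRight, derivWithin_const_mul_field, Prod.smul_snd, Pi.smul_apply,
      smul_eq_mul] at h1 ⊢
    linear_combination c * h1

theorem IsSteklovEigenfunction.zero (g : RotMetric) (σ : ℝ) :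
    g.IsSteklovEigenfunction σ 0 := by
  refine ⟨fun _ => 0, ⟨contDiffOn_const, ?_, ?_⟩, ?_, ?_, ?_, ?_⟩ <;>
    simp [laplacian, normalDerivLeft, normalDerivRight]

/-- The eigenspace of the Dirichlet-to-Neumann map `L_g` for `σ`. -/
def steklovEigenspace (g : RotMetric) (σ : ℝ) : Submodule ℝ ((ℝ → ℝ) × (ℝ → ℝ)) where
  carrier := {φ | g.IsSteklovEigenfunction σ φ}
  add_mem' := IsSteklovEigenfunction.add
  zero_mem' := IsSteklovEigenfunction.zero g σ
  smul_mem' c _ h := h.smul c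

/-- The `k`-th Steklov eigenvalue `σ_k(g)` in `0 = σ_0 < σ_1 ≤ σ_2 ≤ ⋯`, eigenvalues being repeated
according to multiplicity: the least `σ` such that at least `k + 1` eigenvalues, counted with
multiplicity, are `≤ σ`. (Eigenspaces for distinct eigenvalues are independent, so this number of
eigenvalues is the dimension of the sum of the eigenspaces.) -/
noncomputable def steklovEigenvalue (g : RotMetric) (k : ℕ) : ℝ :=
  sInf {σ : ℝ | ((k + 1 : ℕ) : Cardinal) ≤
    Module.rank ℝ ↥(⨆ s : ℝ, ⨆ _ : s ≤ σ, g.steklovEigenspace s)}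

/-- The normalized `k`-th Steklov eigenvalue `σ_k(g) L_g(∂Σ)`. -/
noncomputable def normalizedSteklovEigenvalue (g : RotMetric) (k : ℕ) : ℝ :=
  g.steklovEigenvalue k * g.boundaryLength

end RotMetric

/-- `coth`. -/
noncomputable def hypCot (x : ℝ) : ℝ := Real.cosh x / Real.sinh x

/-- `λ̃_n(β, T) = (4nπ/β) (coth(nT) - √(coth²(nT) - β))`, for `n ≥ 1`. -/
noncomputable def lamTilde (n : ℕ) (β T : ℝ) : ℝ :=
  4 * n * Real.pi / β * (hypCot (n * T) - Real.sqrt (hypCot (n * T) ^ 2 - β))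

/-- `μ̃_0(β, T) = 8π/(Tβ)` and `μ̃_n(β, T) = (4nπ/β) (coth(nT) + √(coth²(nT) - β))` for `n ≥ 1`. -/
noncomputable def muTilde (n : ℕ) (β T : ℝ) : ℝ :=
  if n = 0 then 8 * Real.pi / (T * β)
  else 4 * n * Real.pi / β * (hypCot (n * T) + Real.sqrt (hypCot (n * T) ^ 2 - β))

/-- `T` is a positive solution of `λ̃_k(β, T) = μ̃_l(β, T)`. The number `T_{k,l}(β)` is the unique
one. -/
def IsCrossingTime (k l : ℕ) (β T : ℝ) : Prop :=
  0 < T ∧ lamTilde k β T = muTilde l β T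

/-- Four-dimensional Euclidean space. -/
abbrev E4 : Type := EuclideanSpace ℝ (Fin 4)

/-- `∂X/∂t`. -/
noncomputable def partialT (X : ℝ × ℝ → E4) (p : ℝ × ℝ) : E4 := fderiv ℝ X p (1, 0)

/-- `∂X/∂θ`. -/
noncomputable def partialTheta (X : ℝ × ℝ → E4) (p : ℝ × ℝ) : E4 := fderiv ℝ X p (0, 1)

/-- The tangent plane of the parametrized surface `X` at the point `X p`. -/
noncomputable def tangentPlane (X : ℝ × ℝ → E4) (p : ℝ × ℝ) : Submodule ℝ E4 :=
  Submodule.span ℝ {partialT X p, partialTheta X p}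

/-- `X` is a smooth immersion of the cylinder `[a, b] × 𝕊¹`. -/
structure IsImmersedCylinder (X : ℝ × ℝ → E4) (a b : ℝ) : Prop where
  smooth : ContDiff ℝ ∞ X
  periodic : ∀ t ∈ Icc a b, ∀ θ, X (t, θ + 2 * Real.pi) = X (t, θ)
  immersion : ∀ t ∈ Icc a b, ∀ θ,
    LinearIndependent ℝ ![partialT X (t, θ), partialTheta X (t, θ)]

/-- The surface `X` on `[a, b] × 𝕊¹` is minimal: its mean curvature vector, which is a positive
multiple of the normal component of `G X_tt - 2 F X_tθ + E X_θθ` where `E dt² + 2 F dt dθ + G dθ²`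
is the first fundamental form, vanishes. -/
def IsMinimalSurface (X : ℝ × ℝ → E4) (a b : ℝ) : Prop :=
  ∀ t ∈ Icc a b, ∀ θ,
    ⟪partialTheta X (t, θ), partialTheta X (t, θ)⟫ • partialT (partialT X) (t, θ)
      - (2 * ⟪partialT X (t, θ), partialTheta X (t, θ)⟫) • partialT (partialTheta X) (t, θ)
      + ⟪partialT X (t, θ), partialT X (t, θ)⟫ • partialTheta (partialTheta X) (t, θ)
      ∈ tangentPlane X (t, θ)

/-- The surface `X` on `[a, b] × 𝕊¹` lies in the closed ball of radius `R` about the origin, exactly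
its boundary lies on the sphere bounding the ball, and it meets that sphere orthogonally: at each
boundary point the normal `X` of the sphere is tangent to the surface. -/
structure MeetsBallOrthogonally (X : ℝ × ℝ → E4) (a b R : ℝ) : Prop where
  radius_pos : 0 < R
  interior : ∀ t ∈ Ioo a b, ∀ θ, ‖X (t, θ)‖ < R
  boundary : ∀ t ∈ ({a, b} : Set ℝ), ∀ θ, ‖X (t, θ)‖ = R
  orthogonal : ∀ t ∈ ({a, b} : Set ℝ), ∀ θ, X (t, θ) ∈ tangentPlane X (t, θ)

/-- `X` on `[a, b] × 𝕊¹` descends to the Möbius band, the quotient by the fixed point free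
involution `(t, θ) ↦ (-t, θ + π)`. -/
def DescendsToMoebiusBand (X : ℝ × ℝ → E4) (a b : ℝ) : Prop :=
  b = -a ∧ ∀ t ∈ Icc a b, ∀ θ, X (-t, θ + Real.pi) = X (t, θ)

/-- `g` is the metric induced on its cylinder `[a, b] × 𝕊¹` by `X`, that is, the pullback of the
Euclidean metric. -/
def RotMetric.IsInducedBy (g : RotMetric) (X : ℝ × ℝ → E4) : Prop :=
  ∀ t ∈ Icc g.a g.b, ∀ θ,
    ⟪partialT X (t, θ), partialT X (t, θ)⟫ = g.f t ^ 2 ∧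
    ⟪partialT X (t, θ), partialTheta X (t, θ)⟫ = 0 ∧
    ⟪partialTheta X (t, θ), partialTheta X (t, θ)⟫ = g.f t ^ 2

/-- The parametrization of the `n`-Möbius band. -/
noncomputable def moebiusBand (n : ℕ) (p : ℝ × ℝ) : E4 :=
  !₂[2 * n * Real.sinh p.1 * Real.cos p.2,
    2 * n * Real.sinh p.1 * Real.sin p.2,
    Real.cosh (2 * n * p.1) * Real.cos (2 * n * p.2),
    Real.cosh (2 * n * p.1) * Real.sin (2 * n * p.2)]

/-! ### Hyperbolic functions -/

/-! Upper bound. Let A, B be the values of f at the two ends, L = b - a and β = 4AB/(A+B)² ≤ 1.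
Separation of variables gives, for each mode m ≥ 1, two eigenvalues s, each carried by cos(mθ) and
by sin(mθ). With x = s(A+B)/2 they are the roots of q_m(x) = βx² - 2m coth(mL) x + m², and the
normalized eigenvalue is 4πx. Since the constants contribute the eigenvalue 0, it suffices to find
2n roots at most κ = 2n tanh(nT); this κ is both the smaller root for m = 2n and the larger root for
m = 1 at β = 1, L = T.

If the smaller root for m = 2n is at most κ, the smaller roots for m ≤ 2n suffice. Otherwise L ≥ T
by monotonicity, and a smaller root exceeding κ in mode p is exchanged for the larger root in mode q
= 2n + 1 - p (`highRoot_le_crossingValue`). The exchange rests on q_p(κ) ≤ q_q(κ), in which β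
cancels: it says p² - q² ≤ 2κ(p coth(pL) - q coth(qL)). For (p, q) = (2n, 1) and L = T this is an
equality (`crossingValue_difference`); the right side increases with L
(`hypCot_mul_sub_monotoneOn`); and other pairs with the same sum do no worse, because x coth x has a
decreasing second derivative (`hypCot_difference_quotient`).

Attainment. The induced metric is symmetric under t ↦ -t. Green's identity against cosh(mt) and
sinh(mt) times a trigonometric function shows that every eigenfunction below the critical value has
equal Fourier coefficients on the two circles in the modes 1 ≤ m < 2n, and none for m ≥ 2n
(`steklovEigenspace_le_lowModes`). Such pairs form a space of dimension at most 2 + 2(2n - 1) = 4n,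
so the 4n-th eigenvalue, counted from 0, is not below the critical value.

Geometry. The coordinates of X are harmonic and X is conformal, hence minimal. On the boundary X is
a multiple of ∂X/∂t precisely because of the crossing equation. -/

theorem tanh_lt_tanh {x y : ℝ} (h : x < y) : Real.tanh x < Real.tanh y := by
  rw [Real.tanh_eq_sinh_div_cosh, Real.tanh_eq_sinh_div_cosh,
    div_lt_div_iff₀ (Real.cosh_pos x) (Real.cosh_pos y)]
  have h1 := Real.sinh_pos_iff.2 (sub_pos.2 h)
  rw [Real.sinh_sub] at h1
  linarith

theorem tanh_pos {x : ℝ} (h : 0 < x) : 0 < Real.tanh x := by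
  simpa using tanh_lt_tanh h

theorem tanh_lt_one' (x : ℝ) : Real.tanh x < 1 := by
  rw [Real.tanh_eq_sinh_div_cosh, div_lt_one (Real.cosh_pos x)]
  exact Real.sinh_lt_cosh x

theorem continuous_tanh' : Continuous Real.tanh := by
  have : Real.tanh = fun x => Real.sinh x / Real.cosh x :=
    funext Real.tanh_eq_sinh_div_cosh
  rw [this]
  exact Real.continuous_sinh.div Real.continuous_cosh fun x => (Real.cosh_pos x).ne'

theorem sinh_le_mul_cosh {x : ℝ} (hx : 0 ≤ x) : Real.sinh x ≤ x * Real.cosh x := by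
  have h : MonotoneOn (fun x : ℝ => x * Real.cosh x - Real.sinh x) (Ici 0) := by
    refine monotoneOn_of_hasDerivWithinAt_nonneg (f' := fun x => x * Real.sinh x)
      (convex_Ici 0) (by fun_prop) (fun x _ => ?_) (fun x hx => ?_)
    · have := ((hasDerivAt_id x).mul (Real.hasDerivAt_cosh x)).sub (Real.hasDerivAt_sinh x)
      exact (this.congr_deriv (by simp)).hasDerivWithinAt
    · rw [interior_Ici] at hx
      exact mul_nonneg (le_of_lt hx) (Real.sinh_nonneg_iff.2 (le_of_lt hx))
  have := h (mem_Ici.2 le_rfl) (mem_Ici.2 hx) hx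
  simp at this
  linarith

theorem tanh_le_self {x : ℝ} (hx : 0 ≤ x) : Real.tanh x ≤ x := by
  rw [Real.tanh_eq_sinh_div_cosh, div_le_iff₀ (Real.cosh_pos x)]
  exact sinh_le_mul_cosh hx

theorem half_le_tanh_one : 1 / 2 ≤ Real.tanh 1 := by
  rw [Real.tanh_eq_sinh_div_cosh, div_le_div_iff₀ two_pos (Real.cosh_pos 1), Real.cosh_eq,
    Real.sinh_eq, Real.exp_neg]
  have h : (2 : ℝ) ≤ Real.exp 1 := by linarith [Real.add_one_le_exp (1 : ℝ)]
  have h2 : (Real.exp 1)⁻¹ ≤ 1 / 2 := by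
    rw [inv_le_comm₀ (by positivity) (by norm_num)]; linarith
  linarith

theorem mul_sinh_le_sinh_mul {p x : ℝ} (hp : 1 ≤ p) (hx : 0 ≤ x) :
    p * Real.sinh x ≤ Real.sinh (p * x) := by
  have h : MonotoneOn (fun x : ℝ => Real.sinh (p * x) - p * Real.sinh x) (Ici 0) := by
    refine monotoneOn_of_hasDerivWithinAt_nonneg
      (f' := fun x => Real.cosh (p * x) * p - p * Real.cosh x)
      (convex_Ici 0) (by fun_prop) (fun x _ => ?_) (fun x hx => ?_)
    · have := (((hasDerivAt_id x).const_mul p).sinh).sub ((Real.hasDerivAt_sinh x).const_mul p)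
      exact (this.congr_deriv (by simp)).hasDerivWithinAt
    · rw [interior_Ici] at hx
      have hx : 0 < x := hx
      have : Real.cosh x ≤ Real.cosh (p * x) := by
        rw [Real.cosh_le_cosh, abs_of_pos hx, abs_of_pos (by positivity)]
        nlinarith
      nlinarith
  have := h (mem_Ici.2 le_rfl) (mem_Ici.2 hx) hx
  simp at this
  linarith

theorem one_lt_hypCot {x : ℝ} (hx : 0 < x) : 1 < hypCot x := by
  rw [hypCot, one_lt_div (Real.sinh_pos_iff.2 hx)]
  exact Real.sinh_lt_cosh x

theorem hypCot_le_hypCot {x y : ℝ} (hx : 0 < x) (h : x ≤ y) : hypCot y ≤ hypCot x := by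
  rw [hypCot, hypCot, div_le_div_iff₀ (Real.sinh_pos_iff.2 (hx.trans_le h))
    (Real.sinh_pos_iff.2 hx)]
  have h1 := Real.sinh_nonneg_iff.2 (sub_nonneg.2 h)
  rw [Real.sinh_sub] at h1
  linarith

theorem sqrt_hypCot_sq_sub_one {x : ℝ} (hx : 0 < x) :
    Real.sqrt (hypCot x ^ 2 - 1) = 1 / Real.sinh x := by
  have hs := Real.sinh_pos_iff.2 hx
  rw [← Real.sqrt_sq (show 0 ≤ 1 / Real.sinh x by positivity)]
  congr 1
  rw [hypCot]
  field_simp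
  linarith [Real.cosh_sq x]

theorem hypCot_sub_inv_sinh {x : ℝ} (hx : 0 < x) :
    hypCot x - 1 / Real.sinh x = Real.tanh (x / 2) := by
  have hs : 0 < Real.sinh (x / 2) := Real.sinh_pos_iff.2 (by linarith)
  have hc := Real.cosh_pos (x / 2)
  obtain ⟨y, rfl⟩ : ∃ y, x = 2 * y := ⟨x / 2, by ring⟩
  rw [mul_div_cancel_left₀ y two_ne_zero] at *
  rw [hypCot, Real.tanh_eq_sinh_div_cosh, Real.cosh_two_mul, Real.sinh_two_mul]
  field_simp
  linarith [Real.cosh_sq y]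

theorem hypCot_add_inv_sinh {x : ℝ} (hx : 0 < x) :
    hypCot x + 1 / Real.sinh x = (Real.tanh (x / 2))⁻¹ := by
  have hs : 0 < Real.sinh (x / 2) := Real.sinh_pos_iff.2 (by linarith)
  have hc := Real.cosh_pos (x / 2)
  obtain ⟨y, rfl⟩ : ∃ y, x = 2 * y := ⟨x / 2, by ring⟩
  rw [mul_div_cancel_left₀ y two_ne_zero] at *
  rw [hypCot, Real.tanh_eq_sinh_div_cosh, Real.cosh_two_mul, Real.sinh_two_mul]
  field_simp
  linarith [Real.cosh_sq y]

/-! ### The crossing time -/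

theorem lamTilde_one {k : ℕ} (hk : 1 ≤ k) {s : ℝ} (hs : 0 < s) :
    lamTilde k 1 s = 4 * k * Real.pi * Real.tanh (k * s / 2) := by
  have h : 0 < (k : ℝ) * s := mul_pos (by exact_mod_cast hk) hs
  rw [lamTilde, sqrt_hypCot_sq_sub_one h, hypCot_sub_inv_sinh h, div_one]

theorem muTilde_one {k : ℕ} (hk : 1 ≤ k) {s : ℝ} (hs : 0 < s) :
    muTilde k 1 s = 4 * k * Real.pi * (Real.tanh (k * s / 2))⁻¹ := by
  have h : 0 < (k : ℝ) * s := mul_pos (by exact_mod_cast hk) hs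
  rw [muTilde, if_neg (by omega), sqrt_hypCot_sq_sub_one h, hypCot_add_inv_sinh h, div_one]

/-- At β = 1 the square root is 1/sinh, and coth x ∓ 1/sinh x equals tanh(x/2), respectively
coth(x/2). -/
theorem isCrossingTime_iff {n : ℕ} (hn : 1 ≤ n) {s : ℝ} (hs : 0 < s) :
    IsCrossingTime (2 * n) 1 1 s ↔ 2 * n * Real.tanh (n * s) * Real.tanh (s / 2) = 1 := by
  have ht : 0 < Real.tanh (s / 2) := tanh_pos (by linarith)
  have e : ((2 * n : ℕ) : ℝ) * s / 2 = n * s := by push_cast; ring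
  have e' : ((1 : ℕ) : ℝ) * s / 2 = s / 2 := by push_cast; ring
  rw [IsCrossingTime, lamTilde_one (by omega) hs, muTilde_one le_rfl hs, e, e']
  have hpi := Real.pi_pos
  constructor
  · rintro ⟨-, h⟩
    field_simp at h
    push_cast at h
    linarith
  · intro h
    refine ⟨hs, ?_⟩
    field_simp
    push_cast
    linarith

/-- The left side of the crossing equation in tanh form is continuous, vanishes at 0 and is strictly
increasing for positive arguments. -/
theorem exists_crossingTime {n : ℕ} (hn : 1 ≤ n) :
    ∃ T : ℝ, 0 < T ∧ ∀ s : ℝ, IsCrossingTime (2 * n) 1 1 s ↔ s = T := by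
  have hn' : (1 : ℝ) ≤ n := by exact_mod_cast hn
  let h : ℝ → ℝ := fun s => 2 * n * Real.tanh (n * s) * Real.tanh (s / 2)
  have hcont : Continuous h := by
    have := continuous_tanh'
    fun_prop
  have hmono : ∀ x y, 0 < x → x < y → h x < h y := by
    intro x y hx hxy
    have h1 : Real.tanh (n * x) < Real.tanh (n * y) := tanh_lt_tanh (by nlinarith)
    have h2 : Real.tanh (x / 2) < Real.tanh (y / 2) := tanh_lt_tanh (by linarith)
    have h3 : 0 < Real.tanh (n * x) := tanh_pos (by positivity)
    have h4 : 0 < Real.tanh (x / 2) := tanh_pos (by positivity)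
    have h5 : Real.tanh (n * x) * Real.tanh (x / 2) < Real.tanh (n * y) * Real.tanh (y / 2) :=
      mul_lt_mul'' h1 h2 h3.le h4.le
    simp only [h, mul_assoc]
    nlinarith
  have h0 : h 0 = 0 := by simp [h]
  -- Since tanh 2 ≥ 3/4, the value at 4 is at least 2 · (3/4)² = 9/8 for every n ≥ 1.
  have h4 : 1 ≤ h 4 := by
    have a1 : Real.tanh (2 : ℝ) ≤ Real.tanh (n * 4) := by
      rcases eq_or_lt_of_le (show (2 : ℝ) ≤ n * 4 by linarith) with e | e
      · rw [← e]
      · exact (tanh_lt_tanh e).le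
    have a2 : (3 / 4 : ℝ) ≤ Real.tanh 2 := by
      rw [Real.tanh_eq_sinh_div_cosh, div_le_div_iff₀ (by norm_num) (Real.cosh_pos 2),
        Real.cosh_eq, Real.sinh_eq, Real.exp_neg]
      have b : (3 : ℝ) ≤ Real.exp 2 := by linarith [Real.add_one_le_exp (2 : ℝ)]
      have b2 : (Real.exp 2)⁻¹ ≤ 1 / 3 := by
        rw [inv_le_comm₀ (by positivity) (by norm_num)]; linarith
      linarith
    have a3 : (4 : ℝ) / 2 = 2 := by norm_num
    simp only [h, a3]
    have a4 : (9 / 16 : ℝ) ≤ Real.tanh (n * 4) * Real.tanh 2 := by nlinarith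
    nlinarith
  obtain ⟨T, hT, hT1⟩ := intermediate_value_Icc (by norm_num : (0 : ℝ) ≤ 4) hcont.continuousOn
    (show (1 : ℝ) ∈ Icc (h 0) (h 4) by rw [h0]; exact ⟨zero_le_one, h4⟩)
  have hT0 : 0 < T := by
    rcases eq_or_lt_of_le hT.1 with e | e
    · rw [← e, h0] at hT1; norm_num at hT1
    · exact e
  refine ⟨T, hT0, fun s => ⟨fun hs => ?_, ?_⟩⟩
  · have e : h s = 1 := (isCrossingTime_iff hn hs.1).1 hs
    rcases lt_trichotomy s T with c | c | c
    · have := hmono s T hs.1 c; linarith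
    · exact c
    · have := hmono T s hT0 c; linarith
  · rintro rfl
    exact (isCrossingTime_iff hn hT0).2 hT1

/-! ### The function `x coth x` -/

theorem hasDerivAt_hypCot {x : ℝ} (hx : 0 < x) :
    HasDerivAt hypCot (-(1 / Real.sinh x ^ 2)) x := by
  have hs := Real.sinh_pos_iff.2 hx
  refine ((Real.hasDerivAt_cosh x).div (Real.hasDerivAt_sinh x) hs.ne').congr_deriv ?_
  have := Real.cosh_sq x
  field_simp
  linarith

/-- The derivative 1/sinh²L - p²/sinh²(pL) is nonnegative because p sinh L ≤ sinh(pL). -/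
theorem hypCot_mul_sub_monotoneOn {p : ℝ} (hp : 1 ≤ p) :
    MonotoneOn (fun L => p * hypCot (p * L) - hypCot L) (Ioi 0) := by
  have hp0 : 0 < p := by linarith
  have key : ∀ x ∈ Ioi (0 : ℝ), HasDerivAt (fun L => p * hypCot (p * L) - hypCot L)
      (1 / Real.sinh x ^ 2 - p ^ 2 / Real.sinh (p * x) ^ 2) x := by
    intro x hx
    have hx : 0 < x := hx
    have h1 := (hasDerivAt_hypCot (mul_pos hp0 hx)).comp x ((hasDerivAt_id x).const_mul p)
    refine ((h1.const_mul p).sub (hasDerivAt_hypCot hx)).congr_deriv ?_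
    ring
  refine monotoneOn_of_hasDerivWithinAt_nonneg (convex_Ioi 0)
    (fun x hx => (key x hx).continuousAt.continuousWithinAt)
    (fun x hx => (key x (interior_subset hx)).hasDerivWithinAt) (fun x hx => ?_)
  have hx : 0 < x := interior_subset hx
  have h1 := mul_sinh_le_sinh_mul hp hx.le
  have h2 := Real.sinh_pos_iff.2 hx
  have h3 := Real.sinh_pos_iff.2 (mul_pos hp0 hx)
  rw [sub_nonneg, div_le_div_iff₀ (by positivity) (by positivity), ← mul_pow, one_mul]
  exact pow_le_pow_left₀ (by positivity) h1 2

/-- The second derivative of `x coth x` is decreasing. -/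
theorem antitoneOn_secondDeriv_mul_hypCot :
    AntitoneOn (fun x => 2 * (x * Real.cosh x - Real.sinh x) / Real.sinh x ^ 3) (Ioi 0) := by
  have key : ∀ x ∈ Ioi (0 : ℝ),
      HasDerivAt (fun x => 2 * (x * Real.cosh x - Real.sinh x) / Real.sinh x ^ 3)
      (2 * (3 * Real.sinh x * Real.cosh x - x - 2 * x * Real.cosh x ^ 2) / Real.sinh x ^ 4) x := by
    intro x hx
    have hs := Real.sinh_pos_iff.2 hx
    have h1 := ((((hasDerivAt_id x).mul (Real.hasDerivAt_cosh x)).sub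
      (Real.hasDerivAt_sinh x)).const_mul 2).div ((Real.hasDerivAt_sinh x).pow 3) (pow_pos hs 3).ne'
    refine h1.congr_deriv ?_
    have := Real.cosh_sq x
    simp
    field_simp
    have e : Real.sinh x ^ 2 = Real.cosh x ^ 2 - 1 := by linarith
    rw [e]
    ring
  -- The numerator of the third derivative vanishes at 0 and decreases, as sinh x ≤ x cosh x; so it
  -- is nonpositive.
  have neg : AntitoneOn (fun x => 3 * Real.sinh x * Real.cosh x - x - 2 * x * Real.cosh x ^ 2)
      (Ici 0) := by
    refine antitoneOn_of_hasDerivWithinAt_nonpos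
      (f' := fun x => 4 * Real.sinh x * (Real.sinh x - x * Real.cosh x))
      (convex_Ici 0) (by fun_prop) (fun x _ => ?_) (fun x hx => ?_)
    · have h1 := ((((Real.hasDerivAt_sinh x).const_mul 3).mul (Real.hasDerivAt_cosh x)).sub
        (hasDerivAt_id x)).sub
        (((hasDerivAt_id x).const_mul 2).mul ((Real.hasDerivAt_cosh x).pow 2))
      refine (h1.congr_deriv ?_).hasDerivWithinAt
      simp
      linear_combination Real.cosh_sq x
    · rw [interior_Ici] at hx
      have hx : 0 < x := hx
      have h1 := Real.sinh_pos_iff.2 hx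
      have h2 := sinh_le_mul_cosh hx.le
      exact mul_nonpos_of_nonneg_of_nonpos (by positivity) (by linarith)
  refine antitoneOn_of_hasDerivWithinAt_nonpos (convex_Ioi 0)
    (fun x hx => (key x hx).continuousAt.continuousWithinAt)
    (fun x hx => (key x (interior_subset hx)).hasDerivWithinAt) (fun x hx => ?_)
  have hx : 0 < x := interior_subset hx
  have h1 := neg (mem_Ici.2 le_rfl) (mem_Ici.2 hx.le) hx.le
  simp at h1
  have h2 := Real.sinh_pos_iff.2 hx
  exact div_nonpos_of_nonpos_of_nonneg (by linarith) (by positivity)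

/-- With F(x) = x coth x, the second derivative in h is F''(c + h) - F''(c - h), which is
nonpositive because F'' decreases. The condition H < c keeps c - h in the domain of F. -/
theorem concaveOn_mul_hypCot_sub {c H : ℝ} (hH : H < c) :
    ConcaveOn ℝ (Icc 0 H)
      (fun h => (c + h) * hypCot (c + h) - (c - h) * hypCot (c - h)) := by
  have d1 : ∀ x ∈ Ioi (0 : ℝ), HasDerivAt (fun x => x * hypCot x)
      (hypCot x - x / Real.sinh x ^ 2) x := by
    intro x hx
    refine ((hasDerivAt_id x).mul (hasDerivAt_hypCot hx)).congr_deriv ?_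
    simp
    ring
  have d2 : ∀ x ∈ Ioi (0 : ℝ), HasDerivAt (fun x => hypCot x - x / Real.sinh x ^ 2)
      (2 * (x * Real.cosh x - Real.sinh x) / Real.sinh x ^ 3) x := by
    intro x hx
    have hs := Real.sinh_pos_iff.2 hx
    refine ((hasDerivAt_hypCot hx).sub ((hasDerivAt_id x).div
      ((Real.hasDerivAt_sinh x).pow 2) (pow_pos hs 2).ne')).congr_deriv ?_
    simp
    field_simp
    ring
  have add : ∀ x : ℝ, HasDerivAt (fun h => c + h) 1 x := fun x => (hasDerivAt_id x).const_add c
  have sub : ∀ x : ℝ, HasDerivAt (fun h => c - h) (-1) x := fun x => (hasDerivAt_id x).const_sub c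
  have D1 : ∀ h ∈ Icc 0 H,
      HasDerivAt (fun h => (c + h) * hypCot (c + h) - (c - h) * hypCot (c - h))
      ((hypCot (c + h) - (c + h) / Real.sinh (c + h) ^ 2)
        + (hypCot (c - h) - (c - h) / Real.sinh (c - h) ^ 2)) h := by
    intro h hh
    have p1 : 0 < c + h := by linarith [hh.1, hh.2]
    have p2 : 0 < c - h := by linarith [hh.2]
    refine (((d1 _ p1).comp h (add h)).sub ((d1 _ p2).comp h (sub h))).congr_deriv ?_
    ring
  have D2 : ∀ h ∈ Icc 0 H,
      HasDerivAt (fun h => (hypCot (c + h) - (c + h) / Real.sinh (c + h) ^ 2)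
        + (hypCot (c - h) - (c - h) / Real.sinh (c - h) ^ 2))
      ((2 * ((c + h) * Real.cosh (c + h) - Real.sinh (c + h)) / Real.sinh (c + h) ^ 3)
        - (2 * ((c - h) * Real.cosh (c - h) - Real.sinh (c - h)) / Real.sinh (c - h) ^ 3)) h := by
    intro h hh
    have p1 : 0 < c + h := by linarith [hh.1, hh.2]
    have p2 : 0 < c - h := by linarith [hh.2]
    refine (((d2 _ p1).comp h (add h)).add ((d2 _ p2).comp h (sub h))).congr_deriv ?_
    ring
  refine concaveOn_of_hasDerivWithinAt2_nonpos (convex_Icc 0 H)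
    (fun h hh => (D1 h hh).continuousAt.continuousWithinAt)
    (fun h hh => (D1 h (interior_subset hh)).hasDerivWithinAt)
    (fun h hh => (D2 h (interior_subset hh)).hasDerivWithinAt) (fun h hh => ?_)
  have hh := interior_subset hh
  have p1 : 0 < c + h := by linarith [hh.1, hh.2]
  have p2 : 0 < c - h := by linarith [hh.2]
  have := antitoneOn_secondDeriv_mul_hypCot (mem_Ioi.2 p2) (mem_Ioi.2 p1) (by linarith [hh.1])
  exact sub_nonpos.2 this

/-- Among pairs with a fixed sum, the difference quotient of `m coth(m L)` is the larger the closer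
together the two points are. -/
theorem hypCot_difference_quotient {p q P Q L : ℝ} (hL : 0 < L) (hQ : 0 < Q) (hq : Q ≤ q)
    (hqp : q < p) (hsum : p + q = P + Q) :
    (p - q) * (P * hypCot (P * L) - Q * hypCot (Q * L))
      ≤ (P - Q) * (p * hypCot (p * L) - q * hypCot (q * L)) := by
  have hPQ : 0 < P - Q := by linarith
  have hc := concaveOn_mul_hypCot_sub (c := (P + Q) / 2 * L) (H := (P - Q) / 2 * L)
    (mul_lt_mul_of_pos_right (by linarith) hL)
  have hH : 0 ≤ (P - Q) / 2 * L := by positivity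
  -- The concave function vanishes at 0, so its value at the fraction (p - q)/(P - Q) of the way to
  -- the right end is at least that fraction of its value there.
  have h := hc.2 (left_mem_Icc.2 hH) (right_mem_Icc.2 hH)
    (sub_nonneg.2 ((div_le_one hPQ).2 (by linarith : p - q ≤ P - Q)))
    (div_nonneg (by linarith : 0 ≤ p - q) hPQ.le) (by ring)
  have e1 : (p - q) / (P - Q) * ((P - Q) / 2 * L) = (p - q) / 2 * L := by field_simp
  have e2 : (P + Q) / 2 * L + (p - q) / 2 * L = p * L := by rw [← hsum]; ring
  have e3 : (P + Q) / 2 * L - (p - q) / 2 * L = q * L := by rw [← hsum]; ring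
  have e4 : (P + Q) / 2 * L + (P - Q) / 2 * L = P * L := by ring
  have e5 : (P + Q) / 2 * L - (P - Q) / 2 * L = Q * L := by ring
  simp only [smul_eq_mul, mul_zero, add_zero, sub_zero, zero_add, sub_self, e1, e2, e3, e4, e5] at h
  rw [div_mul_eq_mul_div, div_le_iff₀ hPQ] at h
  refine le_of_mul_le_mul_right ?_ hL
  linarith

/-! ### The Steklov eigenvalues of a cylinder, as roots of quadratic equations -/

/-- The smaller root of `β x² - 2 m coth(m L) x + m² = 0`. -/
noncomputable def lowRoot (β L : ℝ) (m : ℕ) : ℝ :=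
  m / (hypCot (m * L) + Real.sqrt (hypCot (m * L) ^ 2 - β))

/-- The larger root of `β x² - 2 m coth(m L) x + m² = 0`. -/
noncomputable def highRoot (β L : ℝ) (m : ℕ) : ℝ :=
  m / β * (hypCot (m * L) + Real.sqrt (hypCot (m * L) ^ 2 - β))

section Roots

variable {β L : ℝ} {m : ℕ}

theorem one_lt_hypCot_mul (hL : 0 < L) (hm : 1 ≤ m) : 1 < hypCot (m * L) :=
  one_lt_hypCot (mul_pos (by exact_mod_cast hm) hL)

theorem sqrt_disc_pos (hβ : β ≤ 1) (hL : 0 < L) (hm : 1 ≤ m) :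
    0 < Real.sqrt (hypCot (m * L) ^ 2 - β) :=
  Real.sqrt_pos.2 (by nlinarith [one_lt_hypCot_mul hL hm])

theorem sq_sqrt_disc (hβ : β ≤ 1) (hL : 0 < L) (hm : 1 ≤ m) :
    Real.sqrt (hypCot (m * L) ^ 2 - β) ^ 2 = hypCot (m * L) ^ 2 - β :=
  Real.sq_sqrt (by nlinarith [one_lt_hypCot_mul hL hm])

/-- The factorization converts the sign of the quadratic at a point into the position of that point
relative to the two roots. -/
theorem quadratic_eq (hβ0 : 0 < β) (hβ : β ≤ 1) (hL : 0 < L) (hm : 1 ≤ m) (x : ℝ) :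
    β * x ^ 2 - 2 * m * hypCot (m * L) * x + m ^ 2
      = β * (x - lowRoot β L m) * (x - highRoot β L m) := by
  have h1 := one_lt_hypCot_mul hL hm
  have h2 := sqrt_disc_pos hβ hL hm
  have h3 := sq_sqrt_disc hβ hL hm
  rw [lowRoot, highRoot]
  generalize Real.sqrt (hypCot (m * L) ^ 2 - β) = s at *
  generalize hypCot (m * L) = c at *
  have h4 : c + s ≠ 0 := by positivity
  field_simp
  linear_combination x * (m : ℝ) * h3

theorem lowRoot_lt_highRoot (hβ0 : 0 < β) (hβ : β ≤ 1) (hL : 0 < L) (hm : 1 ≤ m) :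
    lowRoot β L m < highRoot β L m := by
  have h1 := one_lt_hypCot_mul hL hm
  have h2 := sqrt_disc_pos hβ hL hm
  have hm' : (0 : ℝ) < m := by exact_mod_cast hm
  rw [lowRoot, highRoot]
  generalize Real.sqrt (hypCot (m * L) ^ 2 - β) = s at *
  generalize hypCot (m * L) = c at *
  rw [div_mul_eq_mul_div, div_lt_div_iff₀ (by positivity) hβ0]
  have : β < (c + s) * (c + s) := by nlinarith
  nlinarith

theorem lowRoot_le_self (hL : 0 < L) (hm : 1 ≤ m) : lowRoot β L m ≤ m := by
  have h1 := one_lt_hypCot_mul hL hm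
  have h2 := Real.sqrt_nonneg (hypCot (m * L) ^ 2 - β)
  exact div_le_self (by positivity) (by linarith)

/-- The smaller root is monotone in all parameters. -/
theorem lowRoot_le_lowRoot {β' L' : ℝ} {m' : ℕ} (hβ' : β' ≤ 1) (hL : 0 < L) (hL' : L ≤ L')
    (hm : 1 ≤ m) (hmm : m ≤ m') (hββ : β ≤ β') : lowRoot β L m ≤ lowRoot β' L' m' := by
  have hm' : (1 : ℝ) ≤ m := by exact_mod_cast hm
  have hmm' : (m : ℝ) ≤ m' := by exact_mod_cast hmm
  have h1 := one_lt_hypCot_mul hL hm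
  have h1' := one_lt_hypCot_mul (hL.trans_le hL') (hm.trans hmm)
  have h2 : hypCot (m' * L') ≤ hypCot (m * L) :=
    hypCot_le_hypCot (by positivity) (mul_le_mul hmm' hL' hL.le (by positivity))
  have h3 : Real.sqrt (hypCot (m' * L') ^ 2 - β') ≤ Real.sqrt (hypCot (m * L) ^ 2 - β) :=
    Real.sqrt_le_sqrt (by nlinarith)
  have h4 := sqrt_disc_pos hβ' (hL.trans_le hL') (hm.trans hmm)
  -- With the square root in the denominator, the numerator grows and the denominator shrinks.
  exact div_le_div₀ (by positivity) hmm' (by positivity) (by linarith)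

theorem lowRoot_one (hL : 0 < L) (hm : 1 ≤ m) : lowRoot 1 L m = m * Real.tanh (m * L / 2) := by
  have h : 0 < (m : ℝ) * L := mul_pos (by exact_mod_cast hm) hL
  rw [lowRoot, sqrt_hypCot_sq_sub_one h, hypCot_add_inv_sinh h, div_inv_eq_mul]

end Roots

theorem hypCot_eq_half_add {x : ℝ} (hx : 0 < x) :
    2 * hypCot x = Real.tanh (x / 2) + (Real.tanh (x / 2))⁻¹ := by
  linear_combination hypCot_sub_inv_sinh hx + hypCot_add_inv_sinh hx

/-! ### Comparison of the roots with the crossing value κ -/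

section Crossing

variable {n : ℕ} {T κ : ℝ}

/-- From tanh(T/2) ≤ T/2 the crossing equation gives 1 ≤ nT tanh(nT) ≤ nT, and tanh 1 ≥ 1/2. The
bound n ≤ κ ensures that a smaller root exceeding κ belongs to a mode p > n. -/
theorem le_crossingValue (hn : 1 ≤ n) (hT : 0 < T)
    (h : 2 * n * Real.tanh (n * T) * Real.tanh (T / 2) = 1) :
    (n : ℝ) ≤ 2 * n * Real.tanh (n * T) := by
  have hn' : (1 : ℝ) ≤ n := by exact_mod_cast hn
  have h1 := tanh_le_self (show 0 ≤ T / 2 by positivity)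
  have h2 := tanh_pos (show 0 < n * T by positivity)
  have h3 := tanh_lt_one' (n * T)
  have h4 : 1 ≤ n * T * Real.tanh (n * T) := by
    have := mul_le_mul_of_nonneg_left h1 (show 0 ≤ 2 * n * Real.tanh (n * T) by positivity)
    linarith
  have h5 : 1 ≤ n * T := by nlinarith [show 0 < n * T by positivity]
  have h6 : Real.tanh 1 ≤ Real.tanh (n * T) := by
    rcases eq_or_lt_of_le h5 with e | e
    · rw [← e]
    · exact (tanh_lt_tanh e).le
  nlinarith [half_le_tanh_one]

/-- At β = 1 and L = T the number κ solves the quadratic equations of the modes 2n and 1;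
subtracting them eliminates κ². -/
theorem crossingValue_difference (hn : 1 ≤ n) (hT : 0 < T)
    (hκ : κ = 2 * n * Real.tanh (n * T)) (h : κ * Real.tanh (T / 2) = 1) :
    2 * κ * (2 * n * hypCot (2 * n * T) - hypCot T) = 4 * n ^ 2 - 1 := by
  have hn' : (1 : ℝ) ≤ n := by exact_mod_cast hn
  have h2 := tanh_pos (show 0 < n * T by positivity)
  have h3 := tanh_pos (show 0 < T / 2 by positivity)
  have e1 := hypCot_eq_half_add (show 0 < 2 * n * T by positivity)
  have e2 := hypCot_eq_half_add hT
  rw [show 2 * n * T / 2 = n * T by ring] at e1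
  have e3 : (Real.tanh (T / 2))⁻¹ = κ := by
    field_simp
    linarith
  have e4 : κ * (Real.tanh (n * T))⁻¹ = 2 * n := by
    rw [hκ]
    field_simp
  rw [e3] at e2
  have e5 : 2 * n * Real.tanh (n * T) = κ := hκ.symm
  linear_combination 2 * n * κ * e1 - κ * e2 + 2 * n * e4 + κ * e5 - h

/-- The crossing value bounds one of the `p`-th smaller root and the `q`-th larger root. -/
theorem highRoot_le_crossingValue (hn : 1 ≤ n) (hT : 0 < T)
    (hκ : κ = 2 * n * Real.tanh (n * T)) (h : κ * Real.tanh (T / 2) = 1)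
    {β L : ℝ} (hβ0 : 0 < β) (hβ : β ≤ 1) (hL : T ≤ L) {p q : ℕ} (hq : 1 ≤ q)
    (hpq : p + q = 2 * n + 1) (hp : κ < lowRoot β L p) : highRoot β L q ≤ κ := by
  have hL0 : 0 < L := hT.trans_le hL
  have hn' : (1 : ℝ) ≤ n := by exact_mod_cast hn
  have hq' : (1 : ℝ) ≤ q := by exact_mod_cast hq
  have hnκ : (n : ℝ) ≤ κ := hκ ▸ le_crossingValue hn hT (hκ ▸ h)
  have hp1 : 1 ≤ p := by
    by_contra hc
    have : p = 0 := by omega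
    rw [this, lowRoot] at hp
    simp at hp
    linarith
  have hnp : n < p := by
    have : (n : ℝ) < p := by linarith [lowRoot_le_self (β := β) hL0 hp1]
    exact_mod_cast this
  have hqn : (q : ℝ) ≤ n := by exact_mod_cast (by omega : q ≤ n)
  have hqp : (q : ℝ) < p := by exact_mod_cast (by omega : q < p)
  have hsum : (p : ℝ) + q = 2 * n + 1 := by exact_mod_cast hpq
  have h1 := hypCot_difference_quotient hL0 one_pos hq' hqp hsum
  have h2 := hypCot_mul_sub_monotoneOn (show (1 : ℝ) ≤ 2 * n by linarith) (mem_Ioi.2 hT)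
    (mem_Ioi.2 hL0) hL
  have h3 := crossingValue_difference hn hT hκ h
  simp only [one_mul] at h1 h2
  have h4 : 4 * (n : ℝ) ^ 2 - 1 ≤ 2 * κ * (2 * n * hypCot (2 * n * L) - hypCot L) := by
    rw [← h3]
    exact mul_le_mul_of_nonneg_left h2 (by linarith)
  -- This says that the quadratic of mode p is at most that of mode q at κ. Since p + q = 2n + 1,
  -- both sides of the extremal case (2n, 1) are rescaled by (p - q)/(2n - 1).
  have h5 : (p : ℝ) ^ 2 - q ^ 2 ≤ 2 * κ * (p * hypCot (p * L) - q * hypCot (q * L)) := by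
    have a : 0 < 2 * (n : ℝ) - 1 := by linarith
    refine le_of_mul_le_mul_left ?_ a
    calc (2 * (n : ℝ) - 1) * (p ^ 2 - q ^ 2) = (p - q) * (4 * (n : ℝ) ^ 2 - 1) := by
          linear_combination (2 * (n : ℝ) - 1) * (p - q) * hsum
      _ ≤ (p - q) * (2 * κ * (2 * n * hypCot (2 * n * L) - hypCot L)) :=
          mul_le_mul_of_nonneg_left h4 (by linarith)
      _ = 2 * κ * ((p - q) * (2 * n * hypCot (2 * n * L) - hypCot L)) := by ring
      _ ≤ 2 * κ * ((2 * n - 1) * (p * hypCot (p * L) - q * hypCot (q * L))) :=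
          mul_le_mul_of_nonneg_left h1 (by linarith)
      _ = _ := by ring
  have h6 := quadratic_eq hβ0 hβ hL0 hp1 κ
  have h7 := quadratic_eq hβ0 hβ hL0 hq κ
  -- As κ lies below both roots of mode p, that quadratic is positive at κ; hence so is the one of
  -- mode q. There κ ≥ n ≥ q is at least the smaller root, so κ must lie beyond the larger one.
  have h8 := lowRoot_lt_highRoot hβ0 hβ hL0 hp1
  have h9 : 0 < β * (κ - lowRoot β L p) * (κ - highRoot β L p) :=
    mul_pos_of_neg_of_neg (mul_neg_of_pos_of_neg hβ0 (by linarith)) (by linarith)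
  have h10 : 0 < β * (κ - lowRoot β L q) * (κ - highRoot β L q) := by
    rw [← h7]
    rw [← h6] at h9
    linarith
  have h11 : 0 ≤ β * (κ - lowRoot β L q) :=
    mul_nonneg hβ0.le (by linarith [lowRoot_le_self (β := β) hL0 hq])
  exact (sub_pos.1 (pos_of_mul_pos_right h10 h11)).le

/-- Each of the smaller roots that fail among the modes 1, …, 2n is replaced by a larger root, the
modes being paired by p ↦ 2n + 1 - p. -/
theorem exists_roots_le_crossingValue (hn : 1 ≤ n) (hT : 0 < T)
    (hκ : κ = 2 * n * Real.tanh (n * T)) (h : κ * Real.tanh (T / 2) = 1)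
    {β L : ℝ} (hβ0 : 0 < β) (hβ : β ≤ 1) (hL : 0 < L) :
    ∃ j k : ℕ, j + k = 2 * n ∧ (∀ m, 1 ≤ m → m ≤ j → lowRoot β L m ≤ κ) ∧
      ∀ m, 1 ≤ m → m ≤ k → highRoot β L m ≤ κ := by
  classical
  by_cases hlow : lowRoot β L (2 * n) ≤ κ
  · exact ⟨2 * n, 0, rfl, fun m hm hm' =>
      (lowRoot_le_lowRoot hβ hL le_rfl hm hm' le_rfl).trans hlow, by omega⟩
  -- If L < T, monotonicity in L and β would bound the smaller root of mode 2n by its value at β =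
  -- 1, L = T, which is κ.
  · have hTL : T ≤ L := by
      by_contra hc
      refine hlow ((lowRoot_le_lowRoot le_rfl hL (not_le.1 hc).le (by omega) le_rfl hβ).trans ?_)
      rw [lowRoot_one hT (by omega), hκ]
      push_cast
      rw [show 2 * n * T / 2 = n * T by ring]
    have hex : ∃ j, κ < lowRoot β L (j + 1) := ⟨2 * n - 1, by
      rw [show 2 * n - 1 + 1 = 2 * n by omega]; exact not_le.1 hlow⟩
    have hle : Nat.find hex ≤ 2 * n := by
      have : Nat.find hex ≤ 2 * n - 1 := Nat.find_min' hex (by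
        rw [show 2 * n - 1 + 1 = 2 * n by omega]; exact not_le.1 hlow)
      omega
    refine ⟨Nat.find hex, 2 * n - Nat.find hex, by omega, fun m hm hm' => ?_, fun m hm hm' => ?_⟩
    · have := Nat.find_min hex (m := m - 1) (by omega)
      rw [Nat.sub_add_cancel hm] at this
      exact not_lt.1 this
    -- The partner 2n + 1 - m is at least j + 1, where j + 1 is the first mode whose smaller root
    -- exceeds κ.
    · refine highRoot_le_crossingValue hn hT hκ h hβ0 hβ hTL hm (p := 2 * n + 1 - m) (by omega) ?_
      exact (Nat.find_spec hex).trans_le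
        (lowRoot_le_lowRoot hβ hL le_rfl (by omega) (by omega) le_rfl)

end Crossing

/-! ### Trigonometric functions and Fourier coefficients -/

/-- `cos (m θ)` or `sin (m θ)`. -/
noncomputable def trig (i : Bool) (m : ℕ) : C(ℝ, ℝ) :=
  if i then ⟨fun θ => Real.cos (m * θ), by fun_prop⟩ else ⟨fun θ => Real.sin (m * θ), by fun_prop⟩

theorem trig_true (m : ℕ) (θ : ℝ) : trig true m θ = Real.cos (m * θ) := rfl

theorem trig_false (m : ℕ) (θ : ℝ) : trig false m θ = Real.sin (m * θ) := rfl

theorem trig_contDiff (i : Bool) (m : ℕ) : ContDiff ℝ ∞ (trig i m) := by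
  cases i
  · change ContDiff ℝ ∞ fun θ => Real.sin (m * θ)
    fun_prop
  · change ContDiff ℝ ∞ fun θ => Real.cos (m * θ)
    fun_prop

theorem trig_periodic (i : Bool) (m : ℕ) (θ : ℝ) : trig i m (θ + 2 * Real.pi) = trig i m θ := by
  cases i
  · rw [trig_false, trig_false, mul_add, Real.sin_add_nat_mul_two_pi]
  · rw [trig_true, trig_true, mul_add, Real.cos_add_nat_mul_two_pi]

theorem exists_deriv_trig (i : Bool) (m : ℕ) : ∃ w' : ℝ → ℝ, ContDiff ℝ ∞ w' ∧
    (∀ θ, w' (θ + 2 * Real.pi) = w' θ) ∧ (∀ θ, HasDerivAt (trig i m) (w' θ) θ) ∧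
    ∀ θ, HasDerivAt w' (-(m ^ 2 * trig i m θ)) θ := by
  cases i
  · refine ⟨fun θ => m * Real.cos (m * θ), by fun_prop, fun θ => ?_, fun θ => ?_, fun θ => ?_⟩
    · simp only [mul_add, Real.cos_add_nat_mul_two_pi]
    · exact (((hasDerivAt_id θ).const_mul (m : ℝ)).sin).congr_deriv (by simp; ring)
    · rw [trig_false]
      exact ((((hasDerivAt_id θ).const_mul (m : ℝ)).cos).const_mul (m : ℝ)).congr_deriv
        (by simp; ring)
  · refine ⟨fun θ => -(m * Real.sin (m * θ)), by fun_prop, fun θ => ?_, fun θ => ?_, fun θ => ?_⟩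
    · simp only [mul_add, Real.sin_add_nat_mul_two_pi]
    · exact (((hasDerivAt_id θ).const_mul (m : ℝ)).cos).congr_deriv (by simp; ring)
    · rw [trig_true]
      exact ((((hasDerivAt_id θ).const_mul (m : ℝ)).sin).const_mul (m : ℝ)).neg.congr_deriv
        (by simp; ring)

theorem integral_cos_int_mul {l : ℤ} (hl : l ≠ 0) :
    ∫ θ in (0 : ℝ)..2 * Real.pi, Real.cos (l * θ) = 0 := by
  rw [intervalIntegral.integral_comp_mul_left _ (by exact_mod_cast hl : (l : ℝ) ≠ 0), integral_cos]
  have : Real.sin (l * (2 * Real.pi)) = 0 := by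
    have := Real.sin_add_int_mul_two_pi 0 l
    simpa using this
  simp [this]

theorem integral_sin_int_mul (l : ℤ) :
    ∫ θ in (0 : ℝ)..2 * Real.pi, Real.sin (l * θ) = 0 := by
  by_cases hl : l = 0
  · simp [hl]
  rw [intervalIntegral.integral_comp_mul_left _ (by exact_mod_cast hl : (l : ℝ) ≠ 0), integral_sin]
  have : Real.cos (l * (2 * Real.pi)) = 1 := by
    have := Real.cos_add_int_mul_two_pi 0 l
    simp
  simp [this]

/-- The functional `φ ↦ ∫ φ(θ) cos(m θ) dθ`, or the same with `sin`. -/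
noncomputable def fourierFunctional (i : Bool) (m : ℕ) : C(ℝ, ℝ) →ₗ[ℝ] ℝ where
  toFun φ := ∫ θ in (0 : ℝ)..2 * Real.pi, φ θ * trig i m θ
  map_add' φ ψ := by
    rw [← intervalIntegral.integral_add
      ((by fun_prop : Continuous fun θ => φ θ * trig i m θ).intervalIntegrable _ _)
      ((by fun_prop : Continuous fun θ => ψ θ * trig i m θ).intervalIntegrable _ _)]
    simp [add_mul]
  map_smul' c φ := by
    simp [mul_assoc, intervalIntegral.integral_const_mul]

theorem fourierFunctional_apply (i : Bool) (m : ℕ) (φ : C(ℝ, ℝ)) :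
    fourierFunctional i m φ = ∫ θ in (0 : ℝ)..2 * Real.pi, φ θ * trig i m θ := rfl

theorem fourierFunctional_trig (i i' : Bool) {m m' : ℕ} (hm : 1 ≤ m) (hm' : 1 ≤ m') :
    fourierFunctional i m (trig i' m') = if m = m' ∧ i = i' then Real.pi else 0 := by
  have hs : ((m : ℤ) + m') ≠ 0 := by omega
  have cc : ∀ l : ℤ, Continuous fun θ : ℝ => Real.cos (l * θ) := fun l => by fun_prop
  have ss : ∀ l : ℤ, Continuous fun θ : ℝ => Real.sin (l * θ) := fun l => by fun_prop
  have C : ∀ l : ℤ, IntervalIntegrable (fun θ : ℝ => Real.cos (l * θ)) MeasureTheory.volume 0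
    (2 * Real.pi) := fun l => (cc l).intervalIntegrable _ _
  have S : ∀ l : ℤ, IntervalIntegrable (fun θ : ℝ => Real.sin (l * θ)) MeasureTheory.volume 0
    (2 * Real.pi) := fun l => (ss l).intervalIntegrable _ _
  have hd : ∫ θ in (0 : ℝ)..2 * Real.pi, Real.cos (((m : ℤ) - m' : ℤ) * θ)
      = if m = m' then 2 * Real.pi else 0 := by
    split_ifs with h
    · simp [h]
    · exact integral_cos_int_mul (by omega)
  rw [fourierFunctional_apply]
  cases i <;> cases i' <;> simp only [trig_true, trig_false]
  · have e : (fun θ : ℝ => Real.sin (m' * θ) * Real.sin (m * θ)) = fun θ =>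
        2⁻¹ * (Real.cos (((m : ℤ) - m' : ℤ) * θ) - Real.cos (((m : ℤ) + m' : ℤ) * θ)) := by
      funext θ
      push_cast
      rw [sub_mul, add_mul, Real.cos_sub, Real.cos_add]
      ring
    rw [e, intervalIntegral.integral_const_mul, intervalIntegral.integral_sub (C _) (C _), hd,
      integral_cos_int_mul hs]
    split_ifs <;> simp_all
  · have e : (fun θ : ℝ => Real.cos (m' * θ) * Real.sin (m * θ)) = fun θ =>
        2⁻¹ * (Real.sin (((m : ℤ) - m' : ℤ) * θ) + Real.sin (((m : ℤ) + m' : ℤ) * θ)) := by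
      funext θ
      push_cast
      rw [sub_mul, add_mul, Real.sin_sub, Real.sin_add]
      ring
    rw [e, intervalIntegral.integral_const_mul, intervalIntegral.integral_add (S _) (S _),
      integral_sin_int_mul, integral_sin_int_mul]
    simp
  · have e : (fun θ : ℝ => Real.sin (m' * θ) * Real.cos (m * θ)) = fun θ =>
        2⁻¹ * (Real.sin (((m : ℤ) + m' : ℤ) * θ) - Real.sin (((m : ℤ) - m' : ℤ) * θ)) := by
      funext θ
      push_cast
      rw [sub_mul, add_mul, Real.sin_sub, Real.sin_add]
      ring
    rw [e, intervalIntegral.integral_const_mul, intervalIntegral.integral_sub (S _) (S _),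
      integral_sin_int_mul, integral_sin_int_mul]
    simp
  · have e : (fun θ : ℝ => Real.cos (m' * θ) * Real.cos (m * θ)) = fun θ =>
        2⁻¹ * (Real.cos (((m : ℤ) - m' : ℤ) * θ) + Real.cos (((m : ℤ) + m' : ℤ) * θ)) := by
      funext θ
      push_cast
      rw [sub_mul, add_mul, Real.cos_sub, Real.cos_add]
      ring
    rw [e, intervalIntegral.integral_const_mul, intervalIntegral.integral_add (C _) (C _), hd,
      integral_cos_int_mul hs]
    split_ifs <;> simp_all

theorem fourierFunctional_one (i : Bool) {m : ℕ} (hm : 1 ≤ m) :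
    fourierFunctional i m 1 = 0 := by
  rw [fourierFunctional_apply]
  cases i
  · simpa [trig_false] using integral_sin_int_mul m
  · simpa [trig_true] using integral_cos_int_mul (l := m) (by omega)

/-! ### Linear independence of boundary values -/

/-- Constants, and for each mode up to `j` one pair of functions on the boundary, and for each mode
up to `k` another one. -/
noncomputable def modeFamily (j k : ℕ) (y z : ℕ → ℝ) :
    Option ((Fin j ⊕ Fin k) × Bool) → C(ℝ, ℝ) × C(ℝ, ℝ)
  | none => (1, 1)
  | some (Sum.inl a, i) => (trig i (a + 1), y (a + 1) • trig i (a + 1))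
  | some (Sum.inr b, i) => (trig i (b + 1), z (b + 1) • trig i (b + 1))

/-- Pairing a relation with one trigonometric function, on each circle separately, leaves at most
two coefficients p, q with p + q = 0 and y p + z q = 0; these vanish because y ≠ z. -/
theorem linearIndependent_modeFamily (j k : ℕ) {y z : ℕ → ℝ} (hyz : ∀ m, 1 ≤ m → y m ≠ z m) :
    LinearIndependent ℝ (modeFamily j k y z) := by
  classical
  rw [Fintype.linearIndependent_iff]
  intro c hc
  have hpi := Real.pi_ne_zero
  have key : ∀ (i : Bool) (m : ℕ), 1 ≤ m →
      (∑ a : Fin j, if m = a + 1 then c (some (Sum.inl a, i)) else 0) = 0 ∧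
      (∑ b : Fin k, if m = b + 1 then c (some (Sum.inr b, i)) else 0) = 0 := by
    intro i m hm
    have h1 := congrArg (fourierFunctional i m ∘ₗ LinearMap.fst ℝ C(ℝ, ℝ) C(ℝ, ℝ)) hc
    have h2 := congrArg (fourierFunctional i m ∘ₗ LinearMap.snd ℝ C(ℝ, ℝ) C(ℝ, ℝ)) hc
    have inner : ∀ (a : ℕ) (r : Bool → ℝ),
        (∑ i', r i' * if m = a + 1 ∧ i = i' then Real.pi else 0)
          = (if m = a + 1 then r i else 0) * Real.pi := by
      intro a r
      by_cases h : m = a + 1 <;> simp [h]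
    have inner' : ∀ (a : ℕ) (r : Bool → ℝ) (w : ℕ → ℝ),
        (∑ i', r i' * (w (a + 1) * if m = a + 1 ∧ i = i' then Real.pi else 0))
          = w m * (if m = a + 1 then r i else 0) * Real.pi := by
      intro a r w
      by_cases h : m = a + 1
      · subst h; simp; ring
      · simp [h]
    rw [map_sum, map_zero] at h1 h2
    simp only [map_smul, Fintype.sum_option, Fintype.sum_prod_type,
      Fintype.sum_sum_type, modeFamily, LinearMap.comp_apply, LinearMap.fst_apply,
      LinearMap.snd_apply, fourierFunctional_one i hm,
      fourierFunctional_trig i _ hm (Nat.le_add_left 1 _), smul_eq_mul, mul_zero, zero_add,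
      inner, inner', ← Finset.sum_mul, ← Finset.mul_sum] at h1 h2
    rw [← add_mul, mul_eq_zero, or_iff_left hpi] at h1 h2
    generalize (∑ a : Fin j, if m = a + 1 then c (some (Sum.inl a, i)) else 0) = p at *
    generalize (∑ b : Fin k, if m = b + 1 then c (some (Sum.inr b, i)) else 0) = q at *
    have h3 : (y m - z m) * p = 0 := by linear_combination h2 - z m * h1
    have hp : p = 0 := (mul_eq_zero.1 h3).resolve_left (sub_ne_zero.2 (hyz m hm))
    exact ⟨hp, by linarith⟩
  have hl : ∀ a i, c (some (Sum.inl a, i)) = 0 := by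
    intro a i
    have := (key i (a + 1) (Nat.le_add_left 1 _)).1
    simpa [Fin.val_inj] using this
  have hr : ∀ b i, c (some (Sum.inr b, i)) = 0 := by
    intro b i
    have := (key i (b + 1) (Nat.le_add_left 1 _)).2
    simpa [Fin.val_inj] using this
  rintro (_ | ⟨a | b, i⟩)
  · rw [Fintype.sum_option, Fintype.sum_prod_type, Fintype.sum_sum_type] at hc
    simp only [hl, hr, zero_smul, Finset.sum_const_zero, add_zero] at hc
    have := congrArg (fun v : C(ℝ, ℝ) × C(ℝ, ℝ) => v.1 0) hc
    simpa [modeFamily] using this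
  · exact hl a i
  · exact hr b i

/-- A pair of continuous functions as a function on the boundary of a cylinder. -/
noncomputable def boundaryPair : C(ℝ, ℝ) × C(ℝ, ℝ) →ₗ[ℝ] (ℝ → ℝ) × (ℝ → ℝ) :=
  (ContinuousMap.coeFnLinearMap ℝ).prodMap (ContinuousMap.coeFnLinearMap ℝ)

theorem boundaryPair_apply (φ : C(ℝ, ℝ) × C(ℝ, ℝ)) :
    boundaryPair φ = (⇑φ.1, ⇑φ.2) := rfl

theorem ker_boundaryPair : LinearMap.ker boundaryPair = ⊥ := by
  refine LinearMap.ker_eq_bot.2 fun φ ψ h => ?_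
  rw [boundaryPair_apply, boundaryPair_apply, Prod.mk.injEq] at h
  exact Prod.ext (DFunLike.coe_injective h.1) (DFunLike.coe_injective h.2)

namespace RotMetric

variable (g : RotMetric)

theorem natCast_le_rank {k : ℕ} {σ : ℝ} {ι : Type} [Fintype ι]
    (hι : Fintype.card ι = k + 1) {v : ι → (ℝ → ℝ) × (ℝ → ℝ)} (hv : LinearIndependent ℝ v)
    (hvE : ∀ x, ∃ s ≤ σ, g.IsSteklovEigenfunction s (v x)) :
    ((k + 1 : ℕ) : Cardinal) ≤
      Module.rank ℝ ↥(⨆ s : ℝ, ⨆ _ : s ≤ σ, g.steklovEigenspace s) := by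
  have hV : ∀ x, v x ∈ (⨆ s : ℝ, ⨆ _ : s ≤ σ, g.steklovEigenspace s) := by
    intro x
    obtain ⟨s, hs, h⟩ := hvE x
    exact (le_iSup₂ (f := fun (s : ℝ) (_ : s ≤ σ) => g.steklovEigenspace s) s hs) h
  have hv' : LinearIndependent ℝ fun x => (⟨v x, hV x⟩ :
      ↥(⨆ s : ℝ, ⨆ _ : s ≤ σ, g.steklovEigenspace s)) :=
    LinearIndependent.of_comp (Submodule.subtype _) hv
  have := hv'.cardinal_le_rank
  rwa [Cardinal.mk_fintype, hι] at this

/-! ### Explicit Steklov eigenfunctions -/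

theorem f_a_pos : 0 < g.f g.a := g.pos _ (left_mem_Icc.2 g.a_lt_b.le)

theorem f_b_pos : 0 < g.f g.b := g.pos _ (right_mem_Icc.2 g.a_lt_b.le)

theorem isSteklovEigenfunction_one : g.IsSteklovEigenfunction 0 (fun _ => 1, fun _ => 1) := by
  refine ⟨fun _ => 1, ⟨contDiffOn_const, ?_, ?_⟩, ?_, ?_, ?_, ?_⟩ <;>
    simp [laplacian, normalDerivLeft, normalDerivRight, iteratedDeriv_const]

theorem iteratedDeriv_two_eq {h h' h'' : ℝ → ℝ} (h1 : ∀ x, HasDerivAt h (h' x) x)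
    (h2 : ∀ x, HasDerivAt h' (h'' x) x) : iteratedDeriv 2 h = h'' := by
  rw [iteratedDeriv_succ, iteratedDeriv_one, funext fun x => (h1 x).deriv,
    funext fun x => (h2 x).deriv]

/-- The radial factor solves h'' = m²h with h(a) = 1 and with h'(a) chosen to satisfy the Steklov
condition at a. The condition at b is then the quadratic equation for s. -/
theorem isSteklovEigenfunction_trig {m : ℕ} (hm : 1 ≤ m) (i : Bool) {s : ℝ}
    (hs : g.f g.a * g.f g.b * s ^ 2
      - m * hypCot (m * (g.b - g.a)) * (g.f g.a + g.f g.b) * s + m ^ 2 = 0) :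
    g.IsSteklovEigenfunction s (trig i m,
      fun θ => (Real.cosh (m * (g.b - g.a))
        - s * g.f g.a / m * Real.sinh (m * (g.b - g.a))) * trig i m θ) := by
  have hm' : (0 : ℝ) < m := by exact_mod_cast hm
  have hA := g.f_a_pos
  have hB := g.f_b_pos
  have hL : 0 < m * (g.b - g.a) := mul_pos hm' (sub_pos.2 g.a_lt_b)
  have hS := Real.sinh_pos_iff.2 hL
  obtain ⟨w', -, -, hw1, hw2⟩ := exists_deriv_trig i m
  let h : ℝ → ℝ := fun t => Real.cosh (m * (t - g.a)) - s * g.f g.a / m * Real.sinh (m * (t - g.a))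
  let h' : ℝ → ℝ := fun t =>
    m * Real.sinh (m * (t - g.a)) - s * g.f g.a * Real.cosh (m * (t - g.a))
  have lin : ∀ t : ℝ, HasDerivAt (fun t => (m : ℝ) * (t - g.a)) m t := fun t =>
    (((hasDerivAt_id t).sub_const g.a).const_mul (m : ℝ)).congr_deriv (by simp)
  have hh : ∀ t, HasDerivAt h (h' t) t := fun t => by
    refine ((lin t).cosh.sub ((lin t).sinh.const_mul _)).congr_deriv ?_
    simp only [h']
    field_simp
  have hh' : ∀ t, HasDerivAt h' (m ^ 2 * h t) t := fun t => by
    refine (((lin t).sinh.const_mul _).sub ((lin t).cosh.const_mul _)).congr_deriv ?_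
    simp only [h]
    field_simp
  have hd : ∀ t ∈ Icc g.a g.b, ∀ θ,
      derivWithin (fun t => h t * trig i m θ) (Icc g.a g.b) t = h' t * trig i m θ := fun t ht θ =>
    ((hh t).mul_const _).hasDerivWithinAt.derivWithin (uniqueDiffOn_Icc g.a_lt_b t ht)
  refine ⟨fun p => h p.1 * trig i m p.2, ⟨?_, fun t _ θ => ?_, fun t _ θ => ?_⟩, fun θ => ?_,
    fun θ => rfl, fun θ => ?_, fun θ => ?_⟩
  · have h1 := (trig_contDiff i m).comp (contDiff_snd (E := ℝ) (F := ℝ))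
    have h2 : ContDiff ℝ ∞ h := by fun_prop
    exact ((h2.comp contDiff_fst).mul h1).contDiffOn
  · simp only [trig_periodic]
  · simp only [laplacian]
    rw [iteratedDeriv_two_eq (fun t => (hh t).mul_const _)
      (fun t => (hh' t).mul_const _), iteratedDeriv_two_eq (fun t => (hw1 t).const_mul _)
      (fun t => (hw2 t).const_mul _)]
    ring
  · simp [h]
  · rw [normalDerivLeft, hd _ (left_mem_Icc.2 g.a_lt_b.le)]
    simp only [h', sub_self, mul_zero, Real.sinh_zero, Real.cosh_zero]
    field_simp
    ring
  · rw [normalDerivRight, hd _ (right_mem_Icc.2 g.a_lt_b.le)]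
    simp only [h', ← mul_assoc]
    congr 1
    rw [hypCot] at hs
    field_simp at hs ⊢
    linear_combination hs

/-- The symmetry parameter of the metric: it equals `1` if both boundary circles are equally long. -/
noncomputable def balance : ℝ := 4 * g.f g.a * g.f g.b / (g.f g.a + g.f g.b) ^ 2

theorem balance_pos : 0 < g.balance := by
  have hA := g.f_a_pos
  have hB := g.f_b_pos
  rw [balance]
  positivity

theorem balance_le_one : g.balance ≤ 1 := by
  have hA := g.f_a_pos
  have hB := g.f_b_pos
  rw [balance, div_le_one (by positivity)]
  nlinarith [sq_nonneg (g.f g.a - g.f g.b)]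

theorem eigenvalue_equation {m : ℕ} {x : ℝ}
    (hx : g.balance * x ^ 2 - 2 * m * hypCot (m * (g.b - g.a)) * x + m ^ 2 = 0) :
    g.f g.a * g.f g.b * (2 * x / (g.f g.a + g.f g.b)) ^ 2
      - m * hypCot (m * (g.b - g.a)) * (g.f g.a + g.f g.b) * (2 * x / (g.f g.a + g.f g.b))
      + m ^ 2 = 0 := by
  have hA := g.f_a_pos
  have hB := g.f_b_pos
  rw [← hx, balance]
  field_simp
  ring

/-- The constants give one eigenfunction and each root gives two, a cosine and a sine: 1 + 2(j + k)
in all. -/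
theorem natCast_le_rank_of_roots {j k N : ℕ} (hN : 2 * (j + k) = N) {κ : ℝ} (hκ : 0 ≤ κ)
    (hlow : ∀ m, 1 ≤ m → m ≤ j → lowRoot g.balance (g.b - g.a) m ≤ κ)
    (hhigh : ∀ m, 1 ≤ m → m ≤ k → highRoot g.balance (g.b - g.a) m ≤ κ) :
    ((N + 1 : ℕ) : Cardinal) ≤ Module.rank ℝ
      ↥(⨆ s : ℝ, ⨆ _ : s ≤ 2 * κ / (g.f g.a + g.f g.b), g.steklovEigenspace s) := by
  have hA := g.f_a_pos
  have hB := g.f_b_pos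
  have hL : 0 < g.b - g.a := sub_pos.2 g.a_lt_b
  let ev : ℝ → ℝ := fun x => 2 * x / (g.f g.a + g.f g.b)
  let amp : (ℕ → ℝ) → ℕ → ℝ := fun r m => Real.cosh (m * (g.b - g.a))
    - ev (r m) * g.f g.a / m * Real.sinh (m * (g.b - g.a))
  have hev : ∀ x y, x ≤ y → ev x ≤ ev y := fun x y h => by
    simp only [ev]
    gcongr
  have hind := linearIndependent_modeFamily j k
    (y := amp (lowRoot g.balance (g.b - g.a))) (z := amp (highRoot g.balance (g.b - g.a))) (by
      intro m hm
      have hm' : (0 : ℝ) < m := by exact_mod_cast hm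
      have hS := Real.sinh_pos_iff.2 (mul_pos hm' hL)
      have hlt := lowRoot_lt_highRoot g.balance_pos g.balance_le_one hL hm
      -- The amplitude on the second circle is strictly decreasing in the root, so the two distinct
      -- roots of a mode give different amplitudes.
      refine (sub_lt_sub_left ?_ _).ne'
      simp only [ev]
      gcongr)
  refine g.natCast_le_rank ?_ (hind.map' boundaryPair ker_boundaryPair) ?_
  · simp [Fintype.card_option, ← hN]
    ring
  · rintro (_ | ⟨a | b, i⟩)
    · exact ⟨0, by positivity, g.isSteklovEigenfunction_one⟩
    · refine ⟨ev (lowRoot g.balance (g.b - g.a) (a + 1)),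
        hev _ _ (hlow _ (by omega) (by omega)), ?_⟩
      refine g.isSteklovEigenfunction_trig (by omega) i (g.eigenvalue_equation ?_)
      rw [quadratic_eq g.balance_pos g.balance_le_one hL (by omega)]
      ring
    · refine ⟨ev (highRoot g.balance (g.b - g.a) (b + 1)),
        hev _ _ (hhigh _ (by omega) (by omega)), ?_⟩
      refine g.isSteklovEigenfunction_trig (by omega) i (g.eigenvalue_equation ?_)
      rw [quadratic_eq g.balance_pos g.balance_le_one hL (by omega)]
      ring

theorem steklovEigenvalue_le_of_roots {j k N : ℕ} (hN : 2 * (j + k) = N) {κ : ℝ} (hκ : 0 ≤ κ)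
    (hlow : ∀ m, 1 ≤ m → m ≤ j → lowRoot g.balance (g.b - g.a) m ≤ κ)
    (hhigh : ∀ m, 1 ≤ m → m ≤ k → highRoot g.balance (g.b - g.a) m ≤ κ) :
    g.steklovEigenvalue N ≤ 2 * κ / (g.f g.a + g.f g.b) := by
  have hA := g.f_a_pos
  have hB := g.f_b_pos
  rw [steklovEigenvalue]
  by_cases hb : BddBelow {σ : ℝ | ((N + 1 : ℕ) : Cardinal) ≤
      Module.rank ℝ ↥(⨆ s : ℝ, ⨆ _ : s ≤ σ, g.steklovEigenspace s)}
  · exact csInf_le hb (g.natCast_le_rank_of_roots hN hκ hlow hhigh)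
  -- The infimum of a set unbounded below is 0 by convention, so the bound holds without knowing
  -- that the eigenvalues are nonnegative.
  · rw [Real.sInf_of_not_bddBelow hb]
    positivity

end RotMetric

namespace RotMetric

variable {g : RotMetric}

/-! ### Green's identity -/

theorem IsHarmonic.hasDerivWithinAt_fst {u : ℝ × ℝ → ℝ} (hu : g.IsHarmonic u) {t : ℝ}
    (ht : t ∈ Icc g.a g.b) (θ : ℝ) :
    HasDerivWithinAt (fun s => u (s, θ)) (fderivWithin ℝ u (Icc g.a g.b ×ˢ univ) (t, θ) (1, 0))
      (Icc g.a g.b) t := by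
  have h1 := (hu.smooth.differentiableOn (by simp) (t, θ) ⟨ht, mem_univ _⟩).hasFDerivWithinAt
  have h2 : HasDerivWithinAt (fun s : ℝ => (s, θ)) ((1 : ℝ), (0 : ℝ)) (Icc g.a g.b) t :=
    ((hasDerivAt_id t).prodMk (hasDerivAt_const t θ)).hasDerivWithinAt
  have h3 : MapsTo (fun s : ℝ => (s, θ)) (Icc g.a g.b) (Icc g.a g.b ×ˢ univ) :=
    fun s hs => ⟨hs, mem_univ _⟩
  exact h1.comp_hasDerivWithinAt t h2 h3

theorem IsHarmonic.hasDerivAt_snd {u : ℝ × ℝ → ℝ} (hu : g.IsHarmonic u) {t : ℝ}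
    (ht : t ∈ Icc g.a g.b) (θ : ℝ) :
    HasDerivAt (fun s => u (t, s)) (fderivWithin ℝ u (Icc g.a g.b ×ˢ univ) (t, θ) (0, 1)) θ := by
  have h1 := (hu.smooth.differentiableOn (by simp) (t, θ) ⟨ht, mem_univ _⟩).hasFDerivWithinAt
  have h2 : HasDerivWithinAt (fun s : ℝ => (t, s)) ((0 : ℝ), (1 : ℝ)) univ θ :=
    ((hasDerivAt_const θ t).prodMk (hasDerivAt_id θ)).hasDerivWithinAt
  exact hasDerivWithinAt_univ.1
    (h1.comp_hasDerivWithinAt θ h2 fun s _ => ⟨ht, mem_univ _⟩)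

theorem IsHarmonic.contDiffOn_partial {u : ℝ × ℝ → ℝ} (hu : g.IsHarmonic u) (v : ℝ × ℝ) :
    ContDiffOn ℝ ∞ (fun p => fderivWithin ℝ u (Icc g.a g.b ×ˢ univ) p v)
      (Icc g.a g.b ×ˢ univ) :=
  (hu.smooth.fderivWithin ((uniqueDiffOn_Icc g.a_lt_b).prod uniqueDiffOn_univ)
    (by simp)).clm_apply contDiffOn_const

/-- The Laplace equation for the slices of u, rewritten for the first partials taken within the
closed cylinder, which are smooth up to the boundary. -/
theorem IsHarmonic.exists_second_derivs {u : ℝ × ℝ → ℝ} (hu : g.IsHarmonic u) {t : ℝ}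
    (ht : t ∈ Ioo g.a g.b) (θ : ℝ) : ∃ p : ℝ,
    HasDerivAt (fun s => fderivWithin ℝ u (Icc g.a g.b ×ˢ univ) (s, θ) (1, 0)) p t ∧
    HasDerivAt (fun s => fderivWithin ℝ u (Icc g.a g.b ×ˢ univ) (t, s) (0, 1)) (-p) θ := by
  have hK : Icc g.a g.b ×ˢ (univ : Set ℝ) ∈ nhds (t, θ) :=
    prod_mem_nhds (Icc_mem_nhds ht.1 ht.2) Filter.univ_mem
  have hd : ∀ v, DifferentiableAt ℝ
      (fun p => fderivWithin ℝ u (Icc g.a g.b ×ˢ univ) p v) (t, θ) := fun v =>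
    ((hu.contDiffOn_partial v).contDiffAt hK).differentiableAt (by simp)
  have h1 : DifferentiableAt ℝ
      (fun s => fderivWithin ℝ u (Icc g.a g.b ×ˢ univ) (s, θ) (1, 0)) t :=
    (hd (1, 0)).comp (f := fun s : ℝ => (s, θ)) t (by fun_prop)
  have h2 : DifferentiableAt ℝ
      (fun s => fderivWithin ℝ u (Icc g.a g.b ×ˢ univ) (t, s) (0, 1)) θ :=
    (hd (0, 1)).comp (f := fun s : ℝ => (t, s)) θ (by fun_prop)
  have e1 : iteratedDeriv 2 (fun s => u (s, θ)) t
      = deriv (fun s => fderivWithin ℝ u (Icc g.a g.b ×ˢ univ) (s, θ) (1, 0)) t := by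
    rw [iteratedDeriv_succ, iteratedDeriv_one]
    refine Filter.EventuallyEq.deriv_eq ?_
    filter_upwards [Ioo_mem_nhds ht.1 ht.2] with s hs
    exact ((hu.hasDerivWithinAt_fst (Ioo_subset_Icc_self hs) θ).hasDerivAt
      (Icc_mem_nhds hs.1 hs.2)).deriv
  have e2 : iteratedDeriv 2 (fun s => u (t, s)) θ
      = deriv (fun s => fderivWithin ℝ u (Icc g.a g.b ×ˢ univ) (t, s) (0, 1)) θ := by
    rw [iteratedDeriv_succ, iteratedDeriv_one]
    congr 1
    funext s
    exact (hu.hasDerivAt_snd (Ioo_subset_Icc_self ht) s).deriv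
  have h := hu.harmonic t ht θ
  have hf := g.pos t (Ioo_subset_Icc_self ht)
  rw [laplacian, mul_eq_zero, or_iff_right (by positivity)] at h
  simp only [e1, e2] at h
  refine ⟨_, h1.hasDerivAt, ?_⟩
  rw [← eq_neg_of_add_eq_zero_right h]
  exact h2.hasDerivAt

/-- Green's identity for a harmonic function and the harmonic function `h(t) w(θ)`. -/
theorem IsHarmonic.green {u : ℝ × ℝ → ℝ} (hu : g.IsHarmonic u) {c : ℝ} {h h' w w' : ℝ → ℝ}
    (ch : ContDiff ℝ ∞ h) (ch' : ContDiff ℝ ∞ h') (cw : ContDiff ℝ ∞ w) (cw' : ContDiff ℝ ∞ w')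
    (dh : ∀ t, HasDerivAt h (h' t) t) (dh' : ∀ t, HasDerivAt h' (c * h t) t)
    (dw : ∀ t, HasDerivAt w (w' t) t) (dw' : ∀ t, HasDerivAt w' (-(c * w t)) t)
    (pw : ∀ θ, w (θ + 2 * Real.pi) = w θ) (pw' : ∀ θ, w' (θ + 2 * Real.pi) = w' θ) :
    ∫ θ in (0 : ℝ)..2 * Real.pi,
      (h g.b * derivWithin (fun t => u (t, θ)) (Icc g.a g.b) g.b - h' g.b * u (g.b, θ)) * w θ
    = ∫ θ in (0 : ℝ)..2 * Real.pi,
      (h g.a * derivWithin (fun t => u (t, θ)) (Icc g.a g.b) g.a - h' g.a * u (g.a, θ)) * w θ := by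
  classical
  set K : Set (ℝ × ℝ) := Icc g.a g.b ×ˢ univ with hK
  have hab := g.a_lt_b
  -- With v = h(t) w(θ), the field (F, G) is v∇u - u∇v, which is divergence free because u and v are
  -- harmonic.
  let F : ℝ × ℝ → ℝ := fun p => (h p.1 * fderivWithin ℝ u K p (1, 0) - h' p.1 * u p) * w p.2
  let G : ℝ × ℝ → ℝ := fun p => (w p.2 * fderivWithin ℝ u K p (0, 1) - w' p.2 * u p) * h p.1
  have c1 : ∀ {k : ℝ → ℝ}, ContDiff ℝ ∞ k → ContDiffOn ℝ ∞ (fun p : ℝ × ℝ => k p.1) K :=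
    fun hk => (hk.comp contDiff_fst).contDiffOn
  have c2 : ∀ {k : ℝ → ℝ}, ContDiff ℝ ∞ k → ContDiffOn ℝ ∞ (fun p : ℝ × ℝ => k p.2) K :=
    fun hk => (hk.comp contDiff_snd).contDiffOn
  have cF : ContDiffOn ℝ ∞ F K :=
    (((c1 ch).mul (hu.contDiffOn_partial _)).sub ((c1 ch').mul hu.smooth)).mul (c2 cw)
  have cG : ContDiffOn ℝ ∞ G K :=
    (((c2 cw).mul (hu.contDiffOn_partial _)).sub ((c2 cw').mul hu.smooth)).mul (c1 ch)
  have hsub : uIcc g.a g.b ×ˢ uIcc 0 (2 * Real.pi) ⊆ K := by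
    rw [uIcc_of_le hab.le]
    exact prod_mono le_rfl (subset_univ _)
  have hint : ∀ x ∈ Ioo g.a g.b ×ˢ (univ : Set ℝ), K ∈ nhds x := fun x hx =>
    prod_mem_nhds (Icc_mem_nhds hx.1.1 hx.1.2) Filter.univ_mem
  have dF : ∀ x ∈ Ioo g.a g.b ×ˢ (univ : Set ℝ), HasFDerivAt F (fderiv ℝ F x) x := fun x hx =>
    ((cF.contDiffAt (hint x hx)).differentiableAt (by simp)).hasFDerivAt
  have dG : ∀ x ∈ Ioo g.a g.b ×ˢ (univ : Set ℝ), HasFDerivAt G (fderiv ℝ G x) x := fun x hx =>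
    ((cG.contDiffAt (hint x hx)).differentiableAt (by simp)).hasFDerivAt
  have hdiv : ∀ x ∈ Ioo g.a g.b ×ˢ (univ : Set ℝ),
      fderiv ℝ F x (1, 0) + fderiv ℝ G x (0, 1) = 0 := by
    rintro ⟨t, θ⟩ hx
    have ht : t ∈ Ioo g.a g.b := hx.1
    have ht' := Ioo_subset_Icc_self ht
    obtain ⟨p, hp1, hp2⟩ := hu.exists_second_derivs ht θ
    have hut := (hu.hasDerivWithinAt_fst ht' θ).hasDerivAt (Icc_mem_nhds ht.1 ht.2)
    have huθ := hu.hasDerivAt_snd ht' θ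
    have s1 : HasDerivAt (fun s => F (s, θ)) (fderiv ℝ F (t, θ) (1, 0)) t :=
      (dF _ hx).comp_hasDerivAt (f := fun s : ℝ => (s, θ)) t ((hasDerivAt_id t).prodMk (hasDerivAt_const t θ))
    have s2 : HasDerivAt (fun s => G (t, s)) (fderiv ℝ G (t, θ) (0, 1)) θ :=
      (dG _ hx).comp_hasDerivAt (f := fun s : ℝ => (t, s)) θ ((hasDerivAt_const θ t).prodMk (hasDerivAt_id θ))
    have s1' := ((((dh t).mul hp1).sub ((dh' t).mul hut)).mul_const (w θ)).unique s1
    have s2' := ((((dw θ).mul hp2).sub ((dw' θ).mul huθ)).mul_const (h t)).unique s2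
    rw [← s1', ← s2']
    ring
  have hIoo : Ioo (min g.a g.b) (max g.a g.b) = Ioo g.a g.b := by
    rw [min_eq_left hab.le, max_eq_right hab.le]
  -- Cutting the derivatives off outside the open strip makes the divergence vanish identically, so
  -- its integrability is trivial.
  let F' : ℝ × ℝ → ℝ × ℝ →L[ℝ] ℝ := fun x => if x.1 ∈ Ioo g.a g.b then fderiv ℝ F x else 0
  let G' : ℝ × ℝ → ℝ × ℝ →L[ℝ] ℝ := fun x => if x.1 ∈ Ioo g.a g.b then fderiv ℝ G x else 0
  have hzero : ∀ x, F' x (1, 0) + G' x (0, 1) = 0 := by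
    intro x
    by_cases hx : x.1 ∈ Ioo g.a g.b
    · simpa only [F', G', if_pos hx] using hdiv x ⟨hx, mem_univ _⟩
    · simp only [F', G', if_neg hx]
      simp
  have main := MeasureTheory.integral2_divergence_prod_of_hasFDerivAt_off_countable F G F' G'
    g.a 0 g.b (2 * Real.pi) ∅ countable_empty (cF.continuousOn.mono hsub)
    (cG.continuousOn.mono hsub)
    (fun x hx => by
      have hx1 : x.1 ∈ Ioo g.a g.b := hIoo ▸ hx.1.1
      simpa only [F', if_pos hx1] using dF x ⟨hx1, mem_univ _⟩)
    (fun x hx => by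
      have hx1 : x.1 ∈ Ioo g.a g.b := hIoo ▸ hx.1.1
      simpa only [G', if_pos hx1] using dG x ⟨hx1, mem_univ _⟩)
    (by simp [hzero])
  -- The sides θ = 0 and θ = 2π of the rectangle contribute equally by periodicity and cancel.
  have hper : ∫ t in g.a..g.b, G (t, 2 * Real.pi) = ∫ t in g.a..g.b, G (t, 0) := by
    refine intervalIntegral.integral_congr fun t ht => ?_
    rw [uIcc_of_le hab.le] at ht
    have e1 : fderivWithin ℝ u K (t, 2 * Real.pi) (0, 1) = fderivWithin ℝ u K (t, 0) (0, 1) := by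
      rw [← (hu.hasDerivAt_snd ht _).deriv, ← (hu.hasDerivAt_snd ht 0).deriv,
        ← zero_add (2 * Real.pi), ← deriv_comp_add_const]
      congr 1
      funext s
      exact hu.periodic t ht s
    have e2 := pw 0
    have e3 := pw' 0
    have e4 := hu.periodic t ht 0
    rw [zero_add] at e2 e3 e4
    simp only [G, e1, e2, e3, e4]
  simp only [hzero, intervalIntegral.integral_zero, hper, sub_self, zero_add] at main
  have hb : ∀ t ∈ Icc g.a g.b, ∀ θ, F (t, θ)
      = (h t * derivWithin (fun t => u (t, θ)) (Icc g.a g.b) t - h' t * u (t, θ)) * w θ := by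
    intro t ht θ
    rw [(hu.hasDerivWithinAt_fst ht θ).derivWithin (uniqueDiffOn_Icc hab t ht)]
  simp only [hb _ (left_mem_Icc.2 hab.le), hb _ (right_mem_Icc.2 hab.le)] at main
  linarith

theorem IsHarmonic.continuous_slice {u : ℝ × ℝ → ℝ} (hu : g.IsHarmonic u) {t : ℝ}
    (ht : t ∈ Icc g.a g.b) : Continuous fun θ => u (t, θ) :=
  continuous_iff_continuousAt.2 fun θ => (hu.hasDerivAt_snd ht θ).continuousAt

theorem IsSteklovEigenfunction.exists_boundaryPair {s : ℝ} {φ : (ℝ → ℝ) × (ℝ → ℝ)}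
    (hφ : g.IsSteklovEigenfunction s φ) : ∃ ψ : C(ℝ, ℝ) × C(ℝ, ℝ), boundaryPair ψ = φ ∧
      (∀ θ, ψ.1 (θ + 2 * Real.pi) = ψ.1 θ) ∧ (∀ θ, ψ.2 (θ + 2 * Real.pi) = ψ.2 θ) := by
  obtain ⟨u, hu, h1, h2, -, -⟩ := hφ
  have ha : g.a ∈ Icc g.a g.b := left_mem_Icc.2 g.a_lt_b.le
  have hb : g.b ∈ Icc g.a g.b := right_mem_Icc.2 g.a_lt_b.le
  refine ⟨(⟨fun θ => u (g.a, θ), hu.continuous_slice ha⟩,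
    ⟨fun θ => u (g.b, θ), hu.continuous_slice hb⟩), ?_, hu.periodic _ ha, hu.periodic _ hb⟩
  rw [boundaryPair_apply]
  exact Prod.ext (funext h1) (funext h2)

/-- Green's identity with the normal derivatives eliminated by the Steklov condition: each solution
of h'' = m²h gives one linear relation between the coefficients on the two circles. -/
theorem IsSteklovEigenfunction.fourier_relation {s : ℝ} {ψ : C(ℝ, ℝ) × C(ℝ, ℝ)}
    (hψ : g.IsSteklovEigenfunction s (boundaryPair ψ)) (i : Bool) (m : ℕ) {h h' : ℝ → ℝ}
    (ch : ContDiff ℝ ∞ h) (ch' : ContDiff ℝ ∞ h') (dh : ∀ t, HasDerivAt h (h' t) t)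
    (dh' : ∀ t, HasDerivAt h' (m ^ 2 * h t) t) :
    (s * g.f g.b * h g.b - h' g.b) * fourierFunctional i m ψ.2
      = -(s * g.f g.a * h g.a + h' g.a) * fourierFunctional i m ψ.1 := by
  obtain ⟨u, hu, h1, h2, h3, h4⟩ := hψ
  obtain ⟨w', cw', pw', dw, dw'⟩ := exists_deriv_trig i m
  have key := hu.green ch ch' (trig_contDiff i m) cw' dh dh' dw dw' (trig_periodic i m) pw'
  have hA := g.f_a_pos
  have hB := g.f_b_pos
  have e1 : ∀ θ, derivWithin (fun t => u (t, θ)) (Icc g.a g.b) g.a = -(s * g.f g.a * ψ.1 θ) := by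
    intro θ
    have := h3 θ
    rw [normalDerivLeft, boundaryPair_apply] at this
    field_simp at this
    linarith
  have e2 : ∀ θ, derivWithin (fun t => u (t, θ)) (Icc g.a g.b) g.b = s * g.f g.b * ψ.2 θ := by
    intro θ
    have := h4 θ
    rw [normalDerivRight, boundaryPair_apply] at this
    field_simp at this
    linarith
  simp only [e1, e2, h1, h2, boundaryPair_apply] at key
  rw [fourierFunctional_apply, fourierFunctional_apply, ← intervalIntegral.integral_const_mul,
    ← intervalIntegral.integral_const_mul]
  refine (intervalIntegral.integral_congr fun θ _ => ?_).trans
    (key.trans (intervalIntegral.integral_congr fun θ _ => ?_)) <;> ring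

end RotMetric

/-! ### Uniqueness of Fourier coefficients and dimension bound -/

/-- The complex Fourier coefficients on the circle vanish as well, so the Fourier series is summable
and converges pointwise to φ. -/
theorem eq_zero_of_fourierFunctional_eq_zero {φ : C(ℝ, ℝ)}
    (hp : ∀ θ, φ (θ + 2 * Real.pi) = φ θ) (h : ∀ i m, fourierFunctional i m φ = 0) : φ = 0 := by
  have : Fact (0 < 2 * Real.pi) := ⟨Real.two_pi_pos⟩
  have hper : Function.Periodic (fun θ => (φ θ : ℂ)) (2 * Real.pi) := fun θ => by
    simp only [hp]
  let f : C(AddCircle (2 * Real.pi), ℂ) := ⟨hper.lift, by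
    refine continuous_coinduced_dom.2 ?_
    exact Complex.continuous_ofReal.comp φ.continuous⟩
  have hf : ∀ θ : ℝ, f (θ : AddCircle (2 * Real.pi)) = φ θ := fun θ => hper.lift_coe θ
  have hcoef : ∀ l : ℤ, fourierCoeff f l = 0 := by
    -- To be used with m = |l| and ε = -sign l, which gives the coefficient of exp(-ilθ).
    have hnat : ∀ (m : ℕ) (ε : ℝ),
        ∫ θ in (0 : ℝ)..2 * Real.pi,
          ((Real.cos (m * θ) : ℂ) + Complex.I * ε * Real.sin (m * θ)) * φ θ = 0 := by
      intro m ε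
      have e : ∀ θ : ℝ, ((Real.cos (m * θ) : ℂ) + Complex.I * ε * Real.sin (m * θ)) * φ θ
          = ((φ θ * trig true m θ : ℝ) : ℂ)
            + Complex.I * ε * ((φ θ * trig false m θ : ℝ) : ℂ) := by
        intro θ
        rw [trig_true, trig_false]
        push_cast
        ring
      simp only [e]
      rw [intervalIntegral.integral_add, intervalIntegral.integral_const_mul,
        intervalIntegral.integral_ofReal, intervalIntegral.integral_ofReal,
        ← fourierFunctional_apply, ← fourierFunctional_apply, h, h]
      · simp
      · exact Continuous.intervalIntegrable (by fun_prop) _ _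
      · exact Continuous.intervalIntegrable (by fun_prop) _ _
    intro l
    rw [fourierCoeff_eq_intervalIntegral f l 0, zero_add]
    have e : ∀ θ : ℝ, fourier (-l) (θ : AddCircle (2 * Real.pi)) • f θ
        = ((Real.cos (l.natAbs * θ) : ℂ) + Complex.I * (-(l.sign : ℝ) : ℝ)
          * Real.sin (l.natAbs * θ)) * φ θ := by
      intro θ
      rw [fourier_coe_apply, hf, smul_eq_mul]
      congr 1
      have hpi : (Real.pi : ℂ) ≠ 0 := by exact_mod_cast Real.pi_ne_zero
      rw [show 2 * (Real.pi : ℂ) * Complex.I * (-l : ℤ) * θ / (2 * Real.pi : ℝ)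
          = ((-(l * θ) : ℝ) : ℂ) * Complex.I by push_cast; field_simp, Complex.exp_mul_I,
        ← Complex.ofReal_cos, ← Complex.ofReal_sin, Real.cos_neg, Real.sin_neg]
      rcases lt_trichotomy l 0 with hl | hl | hl
      · have e1 : (l : ℝ) = -(l.natAbs : ℝ) := by
          have := congrArg (Int.cast : ℤ → ℝ) (by omega : l = -(l.natAbs : ℤ))
          rwa [Int.cast_neg, Int.cast_natCast] at this
        rw [Int.sign_eq_neg_one_of_neg hl, e1, neg_mul, Real.cos_neg, Real.sin_neg]
        push_cast
        ring
      · simp [hl]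
      · have e1 : (l : ℝ) = (l.natAbs : ℝ) := by
          have := congrArg (Int.cast : ℤ → ℝ) (by omega : l = (l.natAbs : ℤ))
          rwa [Int.cast_natCast] at this
        rw [Int.sign_eq_one_of_pos hl, e1]
        push_cast
        ring
    simp only [e, hnat, smul_zero]
  have hsum : Summable (fourierCoeff f) := by
    rw [funext hcoef]
    exact summable_zero
  ext θ
  have h1 := has_pointwise_sum_fourier_series_of_summable hsum (θ : AddCircle (2 * Real.pi))
  simp only [hcoef, zero_smul] at h1
  have h2 := h1.unique hasSum_zero
  rw [hf] at h2
  exact_mod_cast h2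

/-- Pairs of periodic functions whose Fourier coefficients vanish from order `N` on, and agree with
each other in the orders from `1` to `N - 1`. -/
noncomputable def lowModes (N : ℕ) : Submodule ℝ (C(ℝ, ℝ) × C(ℝ, ℝ)) where
  carrier := {ψ | (∀ θ, ψ.1 (θ + 2 * Real.pi) = ψ.1 θ ∧ ψ.2 (θ + 2 * Real.pi) = ψ.2 θ) ∧
    (∀ i m, N ≤ m → fourierFunctional i m ψ.1 = 0 ∧ fourierFunctional i m ψ.2 = 0) ∧
    ∀ i m, 1 ≤ m → m < N → fourierFunctional i m ψ.1 = fourierFunctional i m ψ.2}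
  add_mem' := by
    rintro ψ χ ⟨h1, h2, h3⟩ ⟨k1, k2, k3⟩
    refine ⟨fun θ => ?_, fun i m hm => ?_, fun i m hm hm' => ?_⟩
    · simp [h1 θ, k1 θ]
    · simp [h2 i m hm, k2 i m hm]
    · simp [h3 i m hm hm', k3 i m hm hm']
  zero_mem' := by simp
  smul_mem' := by
    rintro c ψ ⟨h1, h2, h3⟩
    refine ⟨fun θ => ?_, fun i m hm => ?_, fun i m hm hm' => ?_⟩
    · simp [h1 θ]
    · simp [h2 i m hm]
    · simp [h3 i m hm hm']

/-- An element is determined by its two means and, as the circles share the remaining coefficients,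
by one cosine and one sine coefficient for each order from 1 to N - 1. -/
theorem rank_lowModes_le {N : ℕ} (hN : 1 ≤ N) :
    Module.rank ℝ (lowModes N) ≤ ((2 * N : ℕ) : Cardinal) := by
  let Φ : (lowModes N) →ₗ[ℝ] ((Bool ⊕ (Fin (N - 1) × Bool)) → ℝ) :=
    LinearMap.pi (Sum.elim
      (fun c => (fourierFunctional true 0 ∘ₗ
        (if c then LinearMap.fst ℝ C(ℝ, ℝ) C(ℝ, ℝ) else LinearMap.snd ℝ C(ℝ, ℝ) C(ℝ, ℝ))) ∘ₗ
        (lowModes N).subtype)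
      (fun x => (fourierFunctional x.2 (x.1 + 1) ∘ₗ LinearMap.fst ℝ C(ℝ, ℝ) C(ℝ, ℝ)) ∘ₗ
        (lowModes N).subtype))
  have hΦ : Function.Injective Φ := by
    rw [← LinearMap.ker_eq_bot, LinearMap.ker_eq_bot']
    rintro ⟨ψ, h1, h2, h3⟩ h0
    have z1 : fourierFunctional true 0 ψ.1 = 0 := congrFun h0 (Sum.inl true)
    have z2 : fourierFunctional true 0 ψ.2 = 0 := congrFun h0 (Sum.inl false)
    have z3 : ∀ i m, 1 ≤ m → m < N → fourierFunctional i m ψ.1 = 0 := by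
      intro i m hm hm'
      have : fourierFunctional i (m - 1 + 1) ψ.1 = 0 :=
        congrFun h0 (Sum.inr (⟨m - 1, by omega⟩, i))
      rwa [Nat.sub_add_cancel hm] at this
    have z4 : ∀ χ, fourierFunctional false 0 χ = 0 := by
      intro χ
      simp [fourierFunctional_apply, trig_false]
    have y1 : ψ.1 = 0 := by
      refine eq_zero_of_fourierFunctional_eq_zero (fun θ => (h1 θ).1) fun i m => ?_
      rcases Nat.eq_zero_or_pos m with rfl | hm
      · cases i
        · exact z4 _
        · exact z1
      · rcases lt_or_ge m N with hmN | hmN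
        · exact z3 i m hm hmN
        · exact (h2 i m hmN).1
    have y2 : ψ.2 = 0 := by
      refine eq_zero_of_fourierFunctional_eq_zero (fun θ => (h1 θ).2) fun i m => ?_
      rcases Nat.eq_zero_or_pos m with rfl | hm
      · cases i
        · exact z4 _
        · exact z2
      · rcases lt_or_ge m N with hmN | hmN
        · rw [← h3 i m hm hmN]
          exact z3 i m hm hmN
        · exact (h2 i m hmN).2
    exact Subtype.ext (Prod.ext y1 y2)
  have := LinearMap.rank_le_of_injective Φ hΦ
  rw [rank_fun'] at this
  refine this.trans (le_of_eq ?_)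
  simp only [Fintype.card_sum, Fintype.card_prod, Fintype.card_bool, Fintype.card_fin]
  congr 1
  omega

/-! ### Eigenfunctions below the critical value for symmetric metrics -/

namespace RotMetric

variable {g : RotMetric}

/-- On a symmetric cylinder the even and odd parts in t decouple. Mode m has the even eigenvalue m
tanh(mτ)/f(τ) and, for m ≥ 1, the odd eigenvalue m coth(mτ)/f(τ); the hypotheses put s below the
even ones with m ≥ 2n and below all these odd ones. Mode 0 is left unrestricted. -/
theorem steklovEigenspace_le_lowModes {n : ℕ} (hn : 1 ≤ n) {τ s : ℝ} (hτ : 0 < τ) (ha : g.a = -τ)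
    (hb : g.b = τ) (hf : g.f (-τ) = g.f τ)
    (hs1 : s * g.f τ < 2 * n * Real.tanh (2 * n * τ)) (hs2 : s * g.f τ * Real.tanh τ < 1) :
    g.steklovEigenspace s ≤ (lowModes (2 * n)).map boundaryPair := by
  intro φ hφ
  obtain ⟨ψ, rfl, p1, p2⟩ := IsSteklovEigenfunction.exists_boundaryPair hφ
  have hψ : g.IsSteklovEigenfunction s (boundaryPair ψ) := hφ
  refine Submodule.mem_map_of_mem ?_
  have lin : ∀ (m : ℕ) (t : ℝ), HasDerivAt (fun t => (m : ℝ) * t) m t := fun m t =>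
    ((hasDerivAt_id t).const_mul (m : ℝ)).congr_deriv (by simp)
  have even : ∀ (i : Bool) (m : ℕ), (s * g.f τ * Real.cosh (m * τ) - m * Real.sinh (m * τ))
      * (fourierFunctional i m ψ.1 + fourierFunctional i m ψ.2) = 0 := by
    intro i m
    have := hψ.fourier_relation i m (h := fun t => Real.cosh (m * t))
      (h' := fun t => m * Real.sinh (m * t)) (by fun_prop) (by fun_prop)
      (fun t => (lin m t).cosh.congr_deriv (by ring))
      (fun t => ((lin m t).sinh.const_mul _).congr_deriv (by ring))
    simp only [ha, hb, hf, mul_neg, Real.cosh_neg, Real.sinh_neg] at this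
    linear_combination this
  have odd : ∀ (i : Bool) (m : ℕ), (s * g.f τ * Real.sinh (m * τ) - m * Real.cosh (m * τ))
      * (fourierFunctional i m ψ.1 - fourierFunctional i m ψ.2) = 0 := by
    intro i m
    have := hψ.fourier_relation i m (h := fun t => Real.sinh (m * t))
      (h' := fun t => m * Real.cosh (m * t)) (by fun_prop) (by fun_prop)
      (fun t => (lin m t).sinh.congr_deriv (by ring))
      (fun t => ((lin m t).cosh.const_mul _).congr_deriv (by ring))
    simp only [ha, hb, hf, mul_neg, Real.cosh_neg, Real.sinh_neg] at this
    linear_combination -this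
  have tanh_mono : ∀ {x y : ℝ}, x ≤ y → Real.tanh x ≤ Real.tanh y := fun {x y} hxy => by
    rcases eq_or_lt_of_le hxy with e | e
    · rw [e]
    · exact (tanh_lt_tanh e).le
  have equal : ∀ i m, 1 ≤ m → fourierFunctional i m ψ.1 = fourierFunctional i m ψ.2 := by
    intro i m hm
    have hm' : (1 : ℝ) ≤ m := by exact_mod_cast hm
    have hC := Real.cosh_pos (m * τ)
    have hS := Real.sinh_pos_iff.2 (show 0 < m * τ by positivity)
    refine sub_eq_zero.1 ((mul_eq_zero.1 (odd i m)).resolve_left ?_)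
    have key : s * g.f τ * Real.sinh (m * τ) < m * Real.cosh (m * τ) := by
      rcases le_or_gt (s * g.f τ) 0 with h0 | h0
      · have : s * g.f τ * Real.sinh (m * τ) ≤ 0 := mul_nonpos_of_nonpos_of_nonneg h0 hS.le
        have : 0 < m * Real.cosh (m * τ) := by positivity
        linarith
      · have h1 := mul_sinh_le_sinh_mul hm' hτ.le
        -- This is m coth(mτ) ≥ coth τ, so the odd eigenvalue of mode 1 is the least among the modes
        -- m ≥ 1.
        have h2 : Real.tanh (m * τ) ≤ m * Real.tanh τ := by
          rw [Real.tanh_eq_sinh_div_cosh, Real.tanh_eq_sinh_div_cosh, ← mul_div_assoc,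
            div_le_div_iff₀ hC (Real.cosh_pos τ)]
          have h3 : MonotoneOn (fun x : ℝ => m * Real.sinh x * Real.cosh (m * x)
              - Real.sinh (m * x) * Real.cosh x) (Ici 0) := by
            refine monotoneOn_of_hasDerivWithinAt_nonneg
              (f' := fun x => (m ^ 2 - 1) * (Real.sinh x * Real.sinh (m * x)))
              (convex_Ici 0) (by fun_prop) (fun x _ => ?_) (fun x hx => ?_)
            · have := (((Real.hasDerivAt_sinh x).const_mul (m : ℝ)).mul (lin m x).cosh).sub
                ((lin m x).sinh.mul (Real.hasDerivAt_cosh x))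
              exact (this.congr_deriv (by ring)).hasDerivWithinAt
            · rw [interior_Ici] at hx
              have hx : 0 < x := hx
              have := Real.sinh_pos_iff.2 hx
              have := Real.sinh_pos_iff.2 (show 0 < m * x by positivity)
              have : (0 : ℝ) ≤ m ^ 2 - 1 := by nlinarith
              positivity
          have := h3 (mem_Ici.2 le_rfl) (mem_Ici.2 hτ.le) hτ.le
          simp at this
          linarith
        have h4 : s * g.f τ * Real.tanh (m * τ) < m := by
          calc s * g.f τ * Real.tanh (m * τ) ≤ s * g.f τ * (m * Real.tanh τ) :=
                mul_le_mul_of_nonneg_left h2 h0.le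
            _ = m * (s * g.f τ * Real.tanh τ) := by ring
            _ < m := by nlinarith
        rw [Real.tanh_eq_sinh_div_cosh, ← mul_div_assoc, div_lt_iff₀ hC] at h4
        exact h4
    exact (sub_neg.2 key).ne
  have opposite : ∀ i m, 2 * n ≤ m →
      fourierFunctional i m ψ.1 + fourierFunctional i m ψ.2 = 0 := by
    intro i m hm
    have hm' : (2 : ℝ) * n ≤ m := by exact_mod_cast hm
    have hC := Real.cosh_pos (m * τ)
    refine (mul_eq_zero.1 (even i m)).resolve_left ?_
    have h1 : Real.tanh (2 * n * τ) ≤ Real.tanh (m * τ) :=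
      tanh_mono (mul_le_mul_of_nonneg_right hm' hτ.le)
    have h2 : 0 ≤ Real.tanh (2 * n * τ) := by
      have := tanh_mono (show 0 ≤ 2 * n * τ by positivity)
      rwa [Real.tanh_zero] at this
    have h3 : s * g.f τ < m * Real.tanh (m * τ) :=
      hs1.trans_le (mul_le_mul hm' h1 h2 (by positivity))
    rw [Real.tanh_eq_sinh_div_cosh, ← mul_div_assoc, lt_div_iff₀ hC] at h3
    exact (sub_neg.2 h3).ne
  refine ⟨fun θ => ⟨p1 θ, p2 θ⟩, fun i m hm => ?_, fun i m hm _ => equal i m hm⟩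
  have e1 := opposite i m hm
  have e2 := equal i m (by omega)
  constructor <;> linarith

end RotMetric

/-! ### The sharp bound and its attainment -/

namespace RotMetric

theorem normalizedSteklovEigenvalue_le {n : ℕ} (hn : 1 ≤ n) {T : ℝ} (hT : 0 < T)
    (h : 2 * n * Real.tanh (n * T) * Real.tanh (T / 2) = 1) (g : RotMetric) :
    g.normalizedSteklovEigenvalue (4 * n)
      ≤ 4 * Real.pi * (2 * n * Real.tanh (n * T)) := by
  have hA := g.f_a_pos
  have hB := g.f_b_pos
  have hn' : (1 : ℝ) ≤ n := by exact_mod_cast hn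
  have ht := tanh_pos (show 0 < n * T by positivity)
  obtain ⟨j, k, hjk, hlow, hhigh⟩ := exists_roots_le_crossingValue hn hT rfl h g.balance_pos
    g.balance_le_one (sub_pos.2 g.a_lt_b)
  have key := g.steklovEigenvalue_le_of_roots (N := 4 * n) (by omega) (by positivity) hlow hhigh
  rw [le_div_iff₀ (by positivity)] at key
  rw [normalizedSteklovEigenvalue, boundaryLength]
  have := mul_le_mul_of_nonneg_left key (show 0 ≤ 2 * Real.pi by positivity)
  linarith

theorem le_normalizedSteklovEigenvalue {n : ℕ} (hn : 1 ≤ n) {T : ℝ} (hT : 0 < T)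
    (h : 2 * n * Real.tanh (n * T) * Real.tanh (T / 2) = 1) {g : RotMetric} (ha : g.a = -(T / 2))
    (hb : g.b = T / 2) (hf : g.f (-(T / 2)) = g.f (T / 2)) :
    4 * Real.pi * (2 * n * Real.tanh (n * T)) ≤ g.normalizedSteklovEigenvalue (4 * n) := by
  have hB : 0 < g.f (T / 2) := hb ▸ g.f_b_pos
  have hn' : (1 : ℝ) ≤ n := by exact_mod_cast hn
  have ht := tanh_pos (show 0 < n * T by positivity)
  have ht2 := tanh_pos (show 0 < T / 2 by positivity)
  have key : 2 * n * Real.tanh (n * T) / g.f (T / 2) ≤ g.steklovEigenvalue (4 * n) := by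
    obtain ⟨j, k, hjk, hlow, hhigh⟩ := exists_roots_le_crossingValue hn hT rfl h g.balance_pos
      g.balance_le_one (sub_pos.2 g.a_lt_b)
    -- The roots from the upper bound show that the set is nonempty, which a lower bound on the
    -- infimum requires.
    refine le_csInf ⟨_, g.natCast_le_rank_of_roots (N := 4 * n) (by omega) (by positivity)
      hlow hhigh⟩ fun σ hσ => ?_
    by_contra hlt
    rw [not_le, lt_div_iff₀ hB] at hlt
    -- All eigenspaces up to σ lie in one space of dimension at most 4n, one short of the 4n + 1
    -- required.
    have hle : (⨆ s : ℝ, ⨆ _ : s ≤ σ, g.steklovEigenspace s)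
        ≤ (lowModes (2 * n)).map boundaryPair := by
      refine iSup₂_le fun s hs => ?_
      have hs' : s * g.f (T / 2) < 2 * n * Real.tanh (n * T) :=
        (mul_le_mul_of_nonneg_right hs hB.le).trans_lt hlt
      refine steklovEigenspace_le_lowModes hn (half_pos hT) ha hb hf ?_ ?_
      · rwa [show 2 * n * (T / 2) = n * T by ring]
      · rw [← h]
        exact mul_lt_mul_of_pos_right hs' ht2
    have h1 := (Submodule.rank_mono hle).trans
      ((rank_map_le boundaryPair (lowModes (2 * n))).trans (rank_lowModes_le (by omega)))
    have h2 := le_trans (mem_ofPred_eq ▸ hσ) h1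
    have h3 : 4 * n + 1 ≤ 2 * (2 * n) := by exact_mod_cast h2
    omega
  rw [div_le_iff₀ hB] at key
  rw [normalizedSteklovEigenvalue, boundaryLength, ha, hb, hf]
  have := mul_le_mul_of_nonneg_left key (show 0 ≤ 4 * Real.pi by positivity)
  linarith

end RotMetric

/-! ### Geometry of the Möbius band -/

theorem differentiable_of_coord {Y : ℝ × ℝ → E4} (h : ∀ i, ContDiff ℝ ∞ fun p => Y p i) :
    Differentiable ℝ Y :=
  ((contDiff_euclidean (𝕜 := ℝ)).2 h).differentiable (by simp)

theorem partialT_eq {Y Z : ℝ × ℝ → E4} (hY : ∀ i, ContDiff ℝ ∞ fun p => Y p i)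
    (h : ∀ p i, HasDerivAt (fun t => Y (t, p.2) i) (Z p i) p.1) : partialT Y = Z := by
  funext p
  ext i
  have h1 : HasDerivAt (fun t : ℝ => Y (t, p.2)) (fderiv ℝ Y p (1, 0)) p.1 :=
    (differentiable_of_coord hY p).hasFDerivAt.comp_hasDerivAt (f := fun t : ℝ => (t, p.2)) p.1
      ((hasDerivAt_id p.1).prodMk (hasDerivAt_const p.1 p.2))
  have h2 := (EuclideanSpace.proj (𝕜 := ℝ) i).hasFDerivAt.comp_hasDerivAt p.1 h1
  exact h2.unique (h p i)

theorem partialTheta_eq {Y Z : ℝ × ℝ → E4} (hY : ∀ i, ContDiff ℝ ∞ fun p => Y p i)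
    (h : ∀ p i, HasDerivAt (fun θ => Y (p.1, θ) i) (Z p i) p.2) : partialTheta Y = Z := by
  funext p
  ext i
  have h1 : HasDerivAt (fun θ : ℝ => Y (p.1, θ)) (fderiv ℝ Y p (0, 1)) p.2 :=
    (differentiable_of_coord hY p).hasFDerivAt.comp_hasDerivAt (f := fun θ : ℝ => (p.1, θ)) p.2
      ((hasDerivAt_const p.2 p.1).prodMk (hasDerivAt_id p.2))
  have h2 := (EuclideanSpace.proj (𝕜 := ℝ) i).hasFDerivAt.comp_hasDerivAt p.2 h1
  exact h2.unique (h p i)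

section MoebiusBand

variable (n : ℕ)

theorem hasDerivAt_mul_const_id (c x : ℝ) : HasDerivAt (fun x => c * x) c x :=
  ((hasDerivAt_id x).const_mul c).congr_deriv (mul_one c)

theorem hasDerivAt_coord {a b c d : ℝ → ℝ} {a' b' c' d' x : ℝ} (ha : HasDerivAt a a' x)
    (hb : HasDerivAt b b' x) (hc : HasDerivAt c c' x) (hd : HasDerivAt d d' x) (i : Fin 4) :
    HasDerivAt (fun t => !₂[a t, b t, c t, d t] i) (!₂[a', b', c', d'] i) x := by
  fin_cases i
  exacts [ha, hb, hc, hd]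

theorem contDiff_moebiusBand_coord (i : Fin 4) : ContDiff ℝ ∞ fun p => moebiusBand n p i := by
  fin_cases i <;> simp [moebiusBand] <;> fun_prop

theorem partialT_moebiusBand : partialT (moebiusBand n) = fun p =>
    !₂[2 * n * Real.cosh p.1 * Real.cos p.2, 2 * n * Real.cosh p.1 * Real.sin p.2,
      2 * n * Real.sinh (2 * n * p.1) * Real.cos (2 * n * p.2),
      2 * n * Real.sinh (2 * n * p.1) * Real.sin (2 * n * p.2)] := by
  refine partialT_eq (contDiff_moebiusBand_coord n) fun p i => ?_
  have d1 := (Real.hasDerivAt_sinh p.1).const_mul (2 * n : ℝ)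
  have d2 := (hasDerivAt_mul_const_id (2 * n) p.1).cosh
  simp only [moebiusBand]
  refine hasDerivAt_coord ?_ ?_ ?_ ?_ i
  · exact d1.mul_const _
  · exact d1.mul_const _
  · exact (d2.mul_const _).congr_deriv (by ring)
  · exact (d2.mul_const _).congr_deriv (by ring)

theorem partialTheta_moebiusBand : partialTheta (moebiusBand n) = fun p =>
    !₂[-(2 * n * Real.sinh p.1 * Real.sin p.2), 2 * n * Real.sinh p.1 * Real.cos p.2,
      -(2 * n * Real.cosh (2 * n * p.1) * Real.sin (2 * n * p.2)),
      2 * n * Real.cosh (2 * n * p.1) * Real.cos (2 * n * p.2)] := by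
  refine partialTheta_eq (contDiff_moebiusBand_coord n) fun p i => ?_
  have d1 := (hasDerivAt_mul_const_id (2 * n) p.2).cos
  have d2 := (hasDerivAt_mul_const_id (2 * n) p.2).sin
  simp only [moebiusBand]
  refine hasDerivAt_coord ?_ ?_ ?_ ?_ i
  · exact ((Real.hasDerivAt_cos p.2).const_mul _).congr_deriv (by ring)
  · exact (Real.hasDerivAt_sin p.2).const_mul _
  · exact (d1.const_mul _).congr_deriv (by ring)
  · exact (d2.const_mul _).congr_deriv (by ring)

theorem partialT_partialT_moebiusBand : partialT (partialT (moebiusBand n)) = fun p =>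
    !₂[2 * n * Real.sinh p.1 * Real.cos p.2, 2 * n * Real.sinh p.1 * Real.sin p.2,
      4 * n ^ 2 * Real.cosh (2 * n * p.1) * Real.cos (2 * n * p.2),
      4 * n ^ 2 * Real.cosh (2 * n * p.1) * Real.sin (2 * n * p.2)] := by
  rw [partialT_moebiusBand]
  refine partialT_eq (fun i => ?_) fun p i => ?_
  · fin_cases i <;> simp <;> fun_prop
  have d1 := (Real.hasDerivAt_cosh p.1).const_mul (2 * n : ℝ)
  have d2 := (hasDerivAt_mul_const_id (2 * n) p.1).sinh.const_mul (2 * n : ℝ)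
  dsimp only
  refine hasDerivAt_coord ?_ ?_ ?_ ?_ i
  · exact d1.mul_const _
  · exact d1.mul_const _
  · exact (d2.mul_const _).congr_deriv (by ring)
  · exact (d2.mul_const _).congr_deriv (by ring)

theorem partialTheta_partialTheta_moebiusBand : partialTheta (partialTheta (moebiusBand n)) =
    fun p => !₂[-(2 * n * Real.sinh p.1 * Real.cos p.2), -(2 * n * Real.sinh p.1 * Real.sin p.2),
      -(4 * n ^ 2 * Real.cosh (2 * n * p.1) * Real.cos (2 * n * p.2)),
      -(4 * n ^ 2 * Real.cosh (2 * n * p.1) * Real.sin (2 * n * p.2))] := by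
  rw [partialTheta_moebiusBand]
  refine partialTheta_eq (fun i => ?_) fun p i => ?_
  · fin_cases i <;> simp <;> fun_prop
  have d1 := (hasDerivAt_mul_const_id (2 * n) p.2).cos
  have d2 := (hasDerivAt_mul_const_id (2 * n) p.2).sin
  dsimp only
  refine hasDerivAt_coord ?_ ?_ ?_ ?_ i
  · exact ((Real.hasDerivAt_sin p.2).const_mul _).fun_neg
  · exact ((Real.hasDerivAt_cos p.2).const_mul _).congr_deriv (by ring)
  · exact (d2.const_mul _).fun_neg.congr_deriv (by ring)
  · exact (d1.const_mul _).congr_deriv (by ring)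

/-- The coordinates are harmonic in (t, θ). As the parametrization is conformal, the mean curvature
expression is a multiple of X_tt + X_θθ and vanishes. -/
theorem partialTheta_partialTheta_eq_neg (p : ℝ × ℝ) :
    partialTheta (partialTheta (moebiusBand n)) p = -partialT (partialT (moebiusBand n)) p := by
  rw [partialT_partialT_moebiusBand, partialTheta_partialTheta_moebiusBand]
  ext i
  fin_cases i <;> simp

/-- The conformal factor of the metric induced on the Möbius band. -/
noncomputable def moebiusFactor (t : ℝ) : ℝ :=
  2 * n * Real.sqrt (Real.cosh t ^ 2 + Real.sinh (2 * n * t) ^ 2)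

theorem moebiusFactor_sq (t : ℝ) :
    moebiusFactor n t ^ 2 = 4 * n ^ 2 * (Real.cosh t ^ 2 + Real.sinh (2 * n * t) ^ 2) := by
  rw [moebiusFactor, mul_pow, Real.sq_sqrt (by positivity)]
  ring

theorem inner_partialT_partialT (p : ℝ × ℝ) :
    ⟪partialT (moebiusBand n) p, partialT (moebiusBand n) p⟫ = moebiusFactor n p.1 ^ 2 := by
  rw [partialT_moebiusBand, moebiusFactor_sq]
  simp only [PiLp.inner_apply, Fin.sum_univ_four, RCLike.inner_apply, conj_trivial]
  simp
  linear_combination 4 * n ^ 2 * Real.cosh p.1 ^ 2 * Real.sin_sq_add_cos_sq p.2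
    + 4 * n ^ 2 * Real.sinh (2 * n * p.1) ^ 2 * Real.sin_sq_add_cos_sq (2 * n * p.2)

/-- The amplitude 2n of the first two coordinates is what makes the two lengths agree: cosh² - sinh²
= 1 enters twice with the same weight 4n² and opposite signs. -/
theorem inner_partialTheta_partialTheta (p : ℝ × ℝ) :
    ⟪partialTheta (moebiusBand n) p, partialTheta (moebiusBand n) p⟫
      = moebiusFactor n p.1 ^ 2 := by
  rw [partialTheta_moebiusBand, moebiusFactor_sq]
  simp only [PiLp.inner_apply, Fin.sum_univ_four, RCLike.inner_apply, conj_trivial]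
  simp
  linear_combination 4 * n ^ 2 * Real.sinh p.1 ^ 2 * Real.sin_sq_add_cos_sq p.2
    + 4 * n ^ 2 * Real.cosh (2 * n * p.1) ^ 2 * Real.sin_sq_add_cos_sq (2 * n * p.2)
    + 4 * n ^ 2 * Real.cosh_sq (2 * n * p.1) - 4 * n ^ 2 * Real.cosh_sq p.1

theorem inner_partialT_partialTheta (p : ℝ × ℝ) :
    ⟪partialT (moebiusBand n) p, partialTheta (moebiusBand n) p⟫ = 0 := by
  rw [partialT_moebiusBand, partialTheta_moebiusBand]
  simp only [PiLp.inner_apply, Fin.sum_univ_four]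
  simp
  ring

variable {n}

theorem moebiusFactor_pos (hn : 1 ≤ n) (t : ℝ) : 0 < moebiusFactor n t := by
  have hn' : (0 : ℝ) < n := by exact_mod_cast hn
  have := Real.cosh_pos t
  rw [moebiusFactor]
  positivity

theorem isImmersedCylinder_moebiusBand (hn : 1 ≤ n) (a b : ℝ) :
    IsImmersedCylinder (moebiusBand n) a b := by
  refine ⟨(contDiff_euclidean (𝕜 := ℝ)).2 (contDiff_moebiusBand_coord n), fun t _ θ => ?_,
    fun t _ θ => ?_⟩
  · have e : 2 * (n : ℝ) * (θ + 2 * Real.pi) = 2 * n * θ + (2 * n : ℕ) * (2 * Real.pi) := by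
      push_cast
      ring
    simp only [moebiusBand, e, Real.cos_add_two_pi, Real.sin_add_two_pi,
      Real.cos_add_nat_mul_two_pi, Real.sin_add_nat_mul_two_pi]
  · rw [LinearIndependent.pair_iff]
    intro x y hxy
    have hf := moebiusFactor_pos hn t
    have h1 := congrArg (fun v => ⟪partialT (moebiusBand n) (t, θ), v⟫) hxy
    have h2 := congrArg (fun v => ⟪v, partialTheta (moebiusBand n) (t, θ)⟫) hxy
    simp only [inner_add_right, inner_add_left, real_inner_smul_left, real_inner_smul_right,
      inner_partialT_partialT, inner_partialT_partialTheta, inner_partialTheta_partialTheta,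
      inner_zero_left, inner_zero_right, mul_zero, add_zero, zero_add] at h1 h2
    exact ⟨(mul_eq_zero.1 h1).resolve_right (by positivity),
      (mul_eq_zero.1 h2).resolve_right (by positivity)⟩

theorem descendsToMoebiusBand_moebiusBand (τ : ℝ) :
    DescendsToMoebiusBand (moebiusBand n) (-τ) τ := by
  refine ⟨(neg_neg τ).symm, fun t _ θ => ?_⟩
  have e : 2 * (n : ℝ) * (θ + Real.pi) = 2 * n * θ + n * (2 * Real.pi) := by ring
  simp only [moebiusBand, e, mul_neg, Real.sinh_neg, Real.cosh_neg, Real.cos_add_pi,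
    Real.sin_add_pi, neg_mul, neg_neg, Real.cos_add_nat_mul_two_pi, Real.sin_add_nat_mul_two_pi]

theorem isMinimalSurface_moebiusBand (a b : ℝ) : IsMinimalSurface (moebiusBand n) a b := by
  intro t _ θ
  rw [inner_partialTheta_partialTheta, inner_partialT_partialTheta, inner_partialT_partialT,
    partialTheta_partialTheta_eq_neg]
  simp

theorem norm_sq_moebiusBand (p : ℝ × ℝ) :
    ‖moebiusBand n p‖ ^ 2 = 4 * n ^ 2 * Real.sinh p.1 ^ 2 + Real.cosh (2 * n * p.1) ^ 2 := by
  rw [EuclideanSpace.real_norm_sq_eq, Fin.sum_univ_four]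
  simp [moebiusBand]
  linear_combination 4 * n ^ 2 * Real.sinh p.1 ^ 2 * Real.sin_sq_add_cos_sq p.2
    + Real.cosh (2 * n * p.1) ^ 2 * Real.sin_sq_add_cos_sq (2 * n * p.2)

theorem meetsBallOrthogonally_moebiusBand (hn : 1 ≤ n) {τ : ℝ} (hτ : 0 < τ)
    (h : 2 * n * Real.tanh (2 * n * τ) * Real.tanh τ = 1) :
    ∃ R, MeetsBallOrthogonally (moebiusBand n) (-τ) τ R := by
  have hn' : (0 : ℝ) < n := by exact_mod_cast hn
  have hc := Real.cosh_pos (2 * n * τ)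
  have hc1 := Real.cosh_pos τ
  have hs1 := Real.sinh_pos_iff.2 hτ
  have hs2 := Real.sinh_pos_iff.2 (show 0 < 2 * n * τ by positivity)
  refine ⟨Real.sqrt (4 * n ^ 2 * Real.sinh τ ^ 2 + Real.cosh (2 * n * τ) ^ 2), ?_, ?_, ?_, ?_⟩
  · positivity
  · intro t ht θ
    rw [Real.lt_sqrt (norm_nonneg _), norm_sq_moebiusBand]
    have habs : |t| < τ := abs_lt.2 ht
    have h1 : Real.cosh (2 * n * t) < Real.cosh (2 * n * τ) := by
      rw [Real.cosh_lt_cosh, abs_mul, abs_mul _ τ, abs_of_pos hτ]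
      exact mul_lt_mul_of_pos_left habs (by positivity)
    have h2 : Real.cosh t < Real.cosh τ := by
      rwa [Real.cosh_lt_cosh, abs_of_pos hτ]
    have h3 := pow_lt_pow_left₀ h1 (Real.cosh_pos _).le two_ne_zero
    have h4 := pow_lt_pow_left₀ h2 (Real.cosh_pos _).le two_ne_zero
    rw [Real.cosh_sq, Real.cosh_sq] at h4
    have h5 : 4 * (n : ℝ) ^ 2 * Real.sinh t ^ 2 ≤ 4 * n ^ 2 * Real.sinh τ ^ 2 :=
      mul_le_mul_of_nonneg_left (by linarith) (by positivity)
    exact add_lt_add_of_le_of_lt h5 h3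
  · intro t ht θ
    rw [eq_comm, Real.sqrt_eq_iff_eq_sq (by positivity) (norm_nonneg _), norm_sq_moebiusBand]
    rcases ht with rfl | rfl <;> simp
  · rw [Real.tanh_eq_sinh_div_cosh, Real.tanh_eq_sinh_div_cosh] at h
    field_simp at h
    -- At t = ±τ the position is ±tanh τ times ∂X/∂t. For the first two coordinates this is
    -- automatic; for the last two it is the crossing equation.
    have key : ∀ ε : ℝ, (ε = 1 ∨ ε = -1) → ∀ θ, moebiusBand n (ε * τ, θ)
        = (ε * (Real.sinh τ / Real.cosh τ)) • partialT (moebiusBand n) (ε * τ, θ) := by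
      intro ε hε θ
      have e1 : Real.sinh (ε * τ) = ε * (Real.sinh τ / Real.cosh τ) * Real.cosh (ε * τ) := by
        rcases hε with rfl | rfl <;> simp <;> field_simp
      have e2 : Real.cosh (2 * n * (ε * τ))
          = ε * (Real.sinh τ / Real.cosh τ) * (2 * n * Real.sinh (2 * n * (ε * τ))) := by
        rcases hε with rfl | rfl <;> simp <;> field_simp <;> linarith
      rw [partialT_moebiusBand]
      ext i
      fin_cases i <;> simp [moebiusBand]
      · linear_combination 2 * n * Real.cos θ * e1
      · linear_combination 2 * n * Real.sin θ * e1
      · linear_combination Real.cos (2 * n * θ) * e2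
      · linear_combination Real.sin (2 * n * θ) * e2
    have mem : ∀ ε : ℝ, (ε = 1 ∨ ε = -1) → ∀ θ,
        moebiusBand n (ε * τ, θ) ∈ tangentPlane (moebiusBand n) (ε * τ, θ) := by
      intro ε hε θ
      rw [key ε hε θ]
      exact Submodule.smul_mem _ _ (Submodule.subset_span (Or.inl rfl))
    intro t ht θ
    rcases ht with rfl | rfl
    · simpa using mem (-1) (Or.inr rfl) θ
    · simpa using mem 1 (Or.inl rfl) θ

/-- The metric induced on the Möbius band. -/
noncomputable def moebiusMetric (hn : 1 ≤ n) {τ : ℝ} (hτ : 0 < τ) : RotMetric where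
  a := -τ
  b := τ
  a_lt_b := by linarith
  f := moebiusFactor n
  smooth := by
    have h : ContDiff ℝ ∞ (moebiusFactor n) := by
      refine contDiff_const.mul (ContDiff.sqrt (by fun_prop) fun t => ?_)
      have := Real.cosh_pos t
      positivity
    exact h.contDiffOn
  pos t _ := moebiusFactor_pos hn t

theorem moebiusFactor_neg (t : ℝ) : moebiusFactor n (-t) = moebiusFactor n t := by
  simp [moebiusFactor]

end MoebiusBand

theorem mainTheorem4 (n : ℕ) (hn : 1 ≤ n) :
    ∃ T : ℝ, (∀ s : ℝ, IsCrossingTime (2 * n) 1 1 s ↔ s = T) ∧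
      IsImmersedCylinder (moebiusBand n) (-(T / 2)) (T / 2) ∧
      DescendsToMoebiusBand (moebiusBand n) (-(T / 2)) (T / 2) ∧
      IsMinimalSurface (moebiusBand n) (-(T / 2)) (T / 2) ∧
      (∃ R : ℝ, MeetsBallOrthogonally (moebiusBand n) (-(T / 2)) (T / 2) R) ∧
      ∃ g₀ : RotMetric, g₀.a = -(T / 2) ∧ g₀.b = T / 2 ∧ g₀.IsInducedBy (moebiusBand n) ∧
        ∀ g : RotMetric,
          g.normalizedSteklovEigenvalue (4 * n) ≤ g₀.normalizedSteklovEigenvalue (4 * n) := by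
  obtain ⟨T, hT, hcross⟩ := exists_crossingTime hn
  have h := (isCrossingTime_iff hn hT).1 ((hcross T).2 rfl)
  refine ⟨T, hcross, isImmersedCylinder_moebiusBand hn _ _, descendsToMoebiusBand_moebiusBand _,
    isMinimalSurface_moebiusBand _ _, meetsBallOrthogonally_moebiusBand hn (half_pos hT) ?_,
    moebiusMetric hn (half_pos hT), rfl, rfl, fun t _ θ => ⟨inner_partialT_partialT n _,
      inner_partialT_partialTheta n _, inner_partialTheta_partialTheta n _⟩, fun g => ?_⟩
  · rwa [show 2 * n * (T / 2) = n * T by ring]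
  · exact (g.normalizedSteklovEigenvalue_le hn hT h).trans
      (RotMetric.le_normalizedSteklovEigenvalue hn hT h rfl rfl (moebiusFactor_neg _))
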